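/- Consider randomized algorithms for the following problem: find a basis of a hidden finite Abelian group $G$ whose order is not known to the algorithm. The algorithm may request independent uniformly random elements of $G$, may read from the Cayley table of $G$ the product of any two elements obtained so far, may test whether two elements obtained so far are equal, and may toss fair coins; everything else it does is computable. A basis of $G$ is a finite sequence $a_1,\dots,a_t$ of non-identity elements of $G$ ($t\ge 0$) such that $G$ is the internal direct product of the cyclic subgroups $\langle a_1\rangle,\dots,\langle a_t\rangle$. **Theorem.** For every integer $c\ge 0$ there are a randomized algorithm $A$ of this kind and constants $C,k$ such that for every finite Abelian group $G$ the following hold. Every execution of $A$ on $G$ halts with a sequence of elements of $G$ as its output after at most $C\sqrt{|G|}\,(1+\log|G|)^k=\tilde O(\sqrt{|G|})$ accesses, where the random elements requested, the entries of the Cayley table read, and the coins tossed are all counted; and with probability at least $1-|G|^{-c}$ the output is a basis of $G$. -/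

import Mathlib

namespace CayleyOracle

/-- One move of an algorithm that interacts with a hidden finite group. The group elements
received so far are held in registers `0, 1, 2, …`, numbered in order of arrival.
* `sample`: put a uniformly random group element into the next register;
* `mul i j`: read the Cayley table at the elements in registers `i` and `j`, and put their
  product into the next register;
* `coin`: toss a fair coin;
* `output l`: halt and output the group elements in the registers listed in `l`. -/
inductive Action : Type
  | sample : Action
  | mul : ℕ → ℕ → Action
  | coin : Action
  | output : List ℕ → Action

/-- Actions as a disjoint union of standard types, used only to encode them by numbers. -/
def Action.equivSum : Action ≃ (Bool ⊕ (ℕ × ℕ)) ⊕ List ℕ where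
  toFun
    | .sample => .inl (.inl true)
    | .coin => .inl (.inl false)
    | .mul i j => .inl (.inr (i, j))
    | .output l => .inr l
  invFun
    | .inl (.inl true) => .sample
    | .inl (.inl false) => .coin
    | .inl (.inr (i, j)) => .mul i j
    | .inr l => .output l
  left_inv a := by cases a <;> rfl
  right_inv a := by
    rcases a with (b | p) | l
    · cases b <;> rfl
    · rfl
    · rfl

instance : Primcodable Action := Primcodable.ofEquiv _ Action.equivSum

/-- A randomized algorithm with oracle access to a hidden finite group: a machine with a memory
content in `Mem`, which is updated by a computable function of the old content and of the
oracle's last answer, and whose next move is a computable function of the content. -/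
structure Algorithm where
  /-- the possible contents of the memory -/
  Mem : Type
  /-- memory contents are finite objects -/
  [primcodable : Primcodable Mem]
  /-- the initial content -/
  init : Mem
  /-- the next move -/
  act : Mem → Action
  /-- the memory update upon an answer of the oracle -/
  upd : Mem → ℕ → Mem
  act_computable : Computable act
  upd_computable : Computable₂ upd

attribute [instance] Algorithm.primcodable



/-- The distribution of the result of running `A` for at most `T` moves (random elements, reads of
the Cayley table and coin tosses), started with register contents `z` and memory content `m`.
When an element `g` is put into the next register, the algorithm is told the number of the first
register that holds `g` (the number of the new register itself if `g` was not seen before); so it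
can tell which of the registers hold equal elements, and learns nothing else. A coin toss is
answered by `0` or `1`. The result is `none` if the algorithm does not halt within `T` moves or
refers to a register that has not been filled. -/
noncomputable def Algorithm.run {G : Type*} [CommGroup G] [Fintype G] [DecidableEq G]
    (A : Algorithm) :
    ℕ → List G → A.Mem → PMF (Option (List G))
  | 0, z, m =>
    match A.act m with
    | .output l => PMF.pure (l.mapM fun i => z[i]?)
    | _ => PMF.pure none
  | T + 1, z, m =>
    match A.act m with
    | .output l => PMF.pure (l.mapM fun i => z[i]?)
    | .sample =>
      (PMF.uniformOfFintype G).bind fun g => A.run T (z ++ [g]) (A.upd m (z.idxOf g))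
    | .coin =>
      (PMF.uniformOfFintype Bool).bind fun b => A.run T z (A.upd m b.toNat)
    | .mul i j =>
      match z[i]?, z[j]? with
      | some x, some y => A.run T (z ++ [x * y]) (A.upd m (z.idxOf (x * y)))
      | _, _ => PMF.pure none

/-- `a₁, …, a_t` is a basis of the Abelian group `G`: no `a_i` is trivial, and `G` is the (internal)
direct product of the cyclic subgroups generated by `a₁, …, a_t`. -/
def IsBasis {G : Type*} [CommGroup G] (l : List G) : Prop :=
  (∀ a ∈ l, a ≠ 1) ∧
    Function.Bijective fun f : (i : Fin l.length) → Subgroup.zpowers (l.get i) =>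
      ∏ i, (f i : G)

end CayleyOracle

/-!
The algorithm keeps a list of generators of a subgroup `H` of the hidden group `G`, each with its
order modulo the subgroup generated by the previous ones, so that `|H|` is the product of these
relative orders. In each round it draws a random element `g` and determines the least `r ≥ 1` with
`g ^ r ∈ H`. If `r > 1`, then `g` becomes a new generator. If `r = 1` happens often enough in
succession, `H` is taken for the whole group.

*Searching for `r`.* For `R = 1, 2, 4, …` it is tested whether `r ≤ R`. The generators with their
relative orders and `g` with `R` form a mixed radix system with `M = |H| * R` digit strings. This
box is covered by baby steps and giant steps: the first digits go to the baby steps, the last ones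
to the giant steps, and only one digit is split, so both tables have size `O(√M)`
(`Box.length_giant_le`, `length_script_box_le`). Collisions between the tables are exactly the
`j ≤ R` with `g ^ j ∈ H` (`Searching.pow_mem`, `Searching.collision`). As `R` is doubled only if it
is smaller than `r`, always `M ≤ 2 * |G|` (`Searching.script_le_tableCost`). No randomness is
involved here, which gives the bound on the number of moves in the worst case.

*Probability of failure.* As long as `H ≠ G`, a random element lies in `H` with probability
`|H| / |G| ≤ 1 / 2`. The number of successes required in succession, about `(c + 1) * log₂ |H|`, is such
that a wrong subgroup is accepted with probability at most `|G| ^ (-(c + 1))` (`pow_trials_le`),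
and at most `log₂ |G| + 1` subgroups are encountered (`Known.ok`).

*The basis.* When `H` has been accepted, an exhaustive search, which costs no moves, finds
homomorphisms from `H` to cyclic groups `ℤ/d` with product of the `d` equal to `|H|`, and pairs of
registers whose products are mapped to the standard basis. Such data exist by the structure
theorem and since every element of `H` is the product of two registers (`Searching.exists_mul_eq`,
`Known.exists_chart`). Candidates for homomorphisms are tested only on the products read from the
Cayley table. This suffices, because these products *prove* that `|H|` is at most the product of
the relative orders: the same bound holds in every group in which they hold, in particular for the
graph of the candidate in `G × ℤ/d`, if `H = G` (`Known.exists_hom`).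

*Computability.* All internal computations are primitive recursive, as they are composed of
bounded searches and operations on lists.
-/

namespace BasisSearch

open CayleyOracle

open scoped ENNReal

universe u

/-! ### The algorithm -/

/-- The `len` registers that are filled next when the registers `0, …, start - 1` are in use. -/
def regs (start len : ℕ) : List ℕ := (List.range len).map (start + ·)

/-- The table of all `g ^ u * a` with `0 ≤ u ≤ n` and `a` in the list `L` of registers, as a list of
registers: position `u * L.length + i` holds `g ^ u * L[i]`. All but the first `L.length` entries
are new registers, numbered from `start`. -/
def powTable (L : List ℕ) (n start : ℕ) : List ℕ := L ++ regs start (n * L.length)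

/-- The multiplications that fill the new registers of `powTable L n start`. -/
def powScript (g : ℕ) (L : List ℕ) (n start : ℕ) : List (ℕ × ℕ) :=
  ((powTable L n start).take (n * L.length)).map fun i => (g, i)

/-- Stage of the computation of the two tables of baby steps and giant steps.
* `room`: an upper bound for the factor by which the table of baby steps may still grow;
* `baby`, `giant`: the registers that hold the baby steps and the giant steps;
* `script`: the multiplications that compute them. -/
structure Box where
  room : ℕ
  baby : List ℕ
  giant : List ℕ
  script : List (ℕ × ℕ)

/-- The number of baby steps spent on a digit with `m` values. -/
def Box.babies (b : Box) (m : ℕ) : ℕ := min m b.room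

/-- The number of giant steps spent on a digit with `m` values: `⌈m / s⌉`, where `s` is the number
of baby steps. -/
def Box.giants (b : Box) (m : ℕ) : ℕ := (m + b.babies m - 1) / b.babies m

/-- The register for `g ^ s`, where `s` is the number of baby steps: the last entry of the table of
powers of `g` that is computed after the baby steps. -/
def Box.stride (start : ℕ) (b : Box) (gm : ℕ × ℕ) : ℕ :=
  (powTable [gm.1] (b.babies gm.2 - 1)
    (start + b.script.length + (b.babies gm.2 - 1) * b.baby.length)).getD (b.babies gm.2 - 1) 0

/-- One more digit: `gm` consists of the register of an element `g` and the number `m` of values of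
its exponent. With `s` baby steps and `v` giant steps, `s * v ≥ m`, the new baby steps are the
`g ^ u * a` with `0 ≤ u < s` and `a` an old baby step, the new giant steps are the
`g ^ (s * w) * b` with `1 ≤ w ≤ v` and `b` an old giant step. -/
def Box.step (start : ℕ) (b : Box) (gm : ℕ × ℕ) : Box :=
  let s := b.babies gm.2
  let v := b.giants gm.2
  let N₁ := start + b.script.length
  let N₂ := N₁ + (s - 1) * b.baby.length
  let N₃ := N₂ + (s - 1)
  { room := b.room / s
    baby := powTable b.baby (s - 1) N₁
    giant := regs N₃ (v * b.giant.length)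
    script := b.script ++ powScript gm.1 b.baby (s - 1) N₁ ++ powScript gm.1 [gm.1] (s - 1) N₂ ++
      powScript (b.stride start gm) b.giant v N₃ }

/-- The tables for a list of digits, computed in registers from `start` on. Baby steps and giant
steps both start from the element in register `0`, which serves as an origin. -/
def box (start room : ℕ) (l : List (ℕ × ℕ)) : Box :=
  l.foldl (Box.step start) ⟨room, [0], [0], []⟩

/-- The search for the relative order of one element.
* `gens`: generators of the known subgroup `H`, each with its order modulo the subgroup generated by
  the previous ones;
* `cur`: the register of the element whose order modulo `H` is sought;
* `bound`: the orders up to this number are tested;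
* `need`: how many consecutive random elements must still turn out to lie in `H`;
* `start`: the first register used by this search. -/
structure Phase where
  gens : List (ℕ × ℕ)
  cur : ℕ
  bound : ℕ
  need : ℕ
  start : ℕ

/-- The order of the subgroup with the given generators and relative orders. -/
def groupOrder (gens : List (ℕ × ℕ)) : ℕ := (gens.map Prod.snd).prod

/-- The tables for the known subgroup, small enough to be extended by the current element. -/
def Phase.lower (ph : Phase) : Box :=
  box ph.start (groupOrder ph.gens * ph.bound).sqrt ph.gens

/-- The tables for the known subgroup and the powers of the current element. -/
def Phase.upper (ph : Phase) : Box := ph.lower.step ph.start (ph.cur, ph.bound)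

/-- The number of baby steps made with the current element. -/
def Phase.babies (ph : Phase) : ℕ := ph.lower.babies ph.bound

/-- A baby step `g ^ u * a` meets a giant step `g ^ (s * w) * b` with `s * w - u = j`. Registers are
compared through the answers `ans`. -/
def Phase.Collision (ph : Phase) (ans : List ℕ) (j : ℕ) : Prop :=
  ∃ p < ph.upper.baby.length, ∃ q < ph.upper.giant.length,
    ans.getD (ph.upper.baby.getD p 0) 0 = ans.getD (ph.upper.giant.getD q 0) 0 ∧
      ph.babies * (q / ph.lower.giant.length + 1) = j + p / ph.lower.baby.length

/-- The least `j` in `1, …, bound` with a collision, and `bound + 1` if there is none. -/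
noncomputable def Phase.relOrder (ph : Phase) (ans : List ℕ) : ℕ :=
  open Classical in
  (List.range ph.bound).findIdx (fun i => decide (ph.Collision ans (i + 1))) + 1

/-- All lists of length `n` with entries from `L`. -/
def allLists {α : Type*} (L : List α) (n : ℕ) : List (List α) :=
  Nat.rec [[]] (fun _ ls => ls.flatMap fun l => L.map fun a => a :: l) n

/-- A candidate `(d, χ, a, b)` for a homomorphism to `ℤ/d`, whose value at the element first seen in
register `i` is `χ.getD i 0`, together with two registers, the product of which is meant to become an
element of the basis. -/
abbrev Character := ℕ × List ℕ × ℕ × ℕ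

/-- The list `F` of characters describes an isomorphism to a direct product of cyclic groups `ℤ/d` of
total order `h`, which maps the products of the chosen pairs of registers to the standard basis. A
fact `(i, j, k)` says that the product of the elements in registers `i` and `j` is the one in `k`. -/
def IsChart (ans : List ℕ) (facts : List (ℕ × ℕ × ℕ)) (h : ℕ) (F : List Character) : Prop :=
  (∀ f ∈ F, 2 ≤ f.1) ∧
  (∀ f ∈ F, ∀ e ∈ facts,
    (f.2.1.getD e.1 0 + f.2.1.getD e.2.1 0) % f.1 = f.2.1.getD e.2.2 0 % f.1) ∧
  (F.map Prod.fst).prod = h ∧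
  ∀ i < F.length, ∀ j < F.length,
    ((F.getD j default).2.1.getD (ans.getD (F.getD i default).2.2.1 0) 0 +
      (F.getD j default).2.1.getD (ans.getD (F.getD i default).2.2.2 0) 0) %
        (F.getD j default).1 = if i = j then 1 else 0

/-- The characters of an abelian group of order `h` that have to be considered when there are `n`
registers. -/
def characters (n h : ℕ) : List Character :=
  (List.range (h + 1)).flatMap fun d =>
    (allLists (List.range h) n).flatMap fun χ =>
      (List.range n).flatMap fun a => (List.range n).map fun b => (d, χ, a, b)

/-- The lists of characters that have to be considered. -/
def charts (n h : ℕ) : List (List Character) :=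
  (List.range h).flatMap (allLists (characters n h))

/-- A chart, found by exhaustive search. -/
noncomputable def findChart (ans : List ℕ) (facts : List (ℕ × ℕ × ℕ)) (h : ℕ) : List Character :=
  open Classical in
  (charts ans.length h).getD
    ((charts ans.length h).findIdx fun F => decide (IsChart ans facts h F)) []

/-- The content of the memory.
* `phase`: the current search;
* `result`: the output, once it is known;
* `pending`: the next moves; `none` stands for a random element, `some (i, j)` for a product;
* `ans`: the answers so far, one for each register;
* `facts`: the products read from the Cayley table so far, in terms of first occurrences. -/
structure Memory where
  phase : Phase
  result : Option (List ℕ)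
  pending : List (Option (ℕ × ℕ))
  ans : List ℕ
  facts : List (ℕ × ℕ × ℕ)

/-- `⌈log₂ h⌉` -/
def bits (h : ℕ) : ℕ := (List.range (h + 1)).findIdx fun q => decide (h ≤ 2 ^ q)

/-- The number of consecutive random elements that must lie in a subgroup of order `h` before this
subgroup is taken for the whole group. -/
def trials (c h : ℕ) : ℕ := (c + 1) * (bits h + 1)

/-- Draw a random element and start the search for its relative order. -/
def begin (gens : List (ℕ × ℕ)) (need : ℕ) (ans : List ℕ) (facts : List (ℕ × ℕ × ℕ)) : Memory :=
  let ph : Phase := ⟨gens, ans.length, 1, need, ans.length + 1⟩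
  ⟨ph, none, none :: ph.upper.script.map some, ans, facts⟩

/-- Repeat the search with twice the bound. -/
def widen (ph : Phase) (ans : List ℕ) (facts : List (ℕ × ℕ × ℕ)) : Memory :=
  let ph' : Phase := ⟨ph.gens, ph.cur, 2 * ph.bound, ph.need, ans.length⟩
  ⟨ph', none, ph'.upper.script.map some, ans, facts⟩

/-- Compute and output a basis of the known subgroup. -/
noncomputable def finish (ph : Phase) (ans : List ℕ) (facts : List (ℕ × ℕ × ℕ)) : Memory :=
  let F := findChart ans facts (groupOrder ph.gens)
  ⟨ph, some (regs ans.length F.length), F.map fun f => some f.2.2, ans, facts⟩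

/-- What to do after the tables of a search have been computed: double the bound if no order was
found; otherwise count another element of the known subgroup, or add a new generator. -/
noncomputable def plan (c : ℕ) (m : Memory) : Memory :=
  let r := m.phase.relOrder m.ans
  if m.phase.bound < r then widen m.phase m.ans m.facts
  else if r = 1 then
    if m.phase.need ≤ 1 then finish m.phase m.ans m.facts
    else begin m.phase.gens (m.phase.need - 1) m.ans m.facts
  else begin (m.phase.gens ++ [(m.phase.cur, r)]) (trials c (groupOrder m.phase.gens * r))
    m.ans m.facts

/-- Note the answer to the first pending move. -/
def record (m : Memory) (a : ℕ) : Memory :=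
  ⟨m.phase, m.result, m.pending.tail, m.ans ++ [a],
    m.facts ++ (m.pending.headI.map fun ij =>
      (m.ans.getD ij.1 0, m.ans.getD ij.2 0, a)).toList⟩

/-- The memory update. -/
noncomputable def update (c : ℕ) (m : Memory) (a : ℕ) : Memory :=
  if (record m a).pending = [] ∧ (record m a).result = none then plan c (record m a)
  else record m a

/-- The next move. -/
def move (m : Memory) : Action :=
  match m.pending.head? with
  | none => .output (m.result.getD [])
  | some none => .sample
  | some (some ij) => .mul ij.1 ij.2

/-! ### Computability of the algorithm -/

/-- Boxes as tuples, used only to encode them by numbers. -/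
def Box.equivProd : Box ≃ ℕ × List ℕ × List ℕ × List (ℕ × ℕ) where
  toFun b := (b.room, b.baby, b.giant, b.script)
  invFun p := ⟨p.1, p.2.1, p.2.2.1, p.2.2.2⟩
  left_inv _ := rfl
  right_inv _ := rfl

instance : Primcodable Box := Primcodable.ofEquiv _ Box.equivProd

/-- Phases as tuples, used only to encode them by numbers. -/
def Phase.equivProd : Phase ≃ List (ℕ × ℕ) × ℕ × ℕ × ℕ × ℕ where
  toFun b := (b.gens, b.cur, b.bound, b.need, b.start)
  invFun p := ⟨p.1, p.2.1, p.2.2.1, p.2.2.2.1, p.2.2.2.2⟩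
  left_inv _ := rfl
  right_inv _ := rfl

instance : Primcodable Phase := Primcodable.ofEquiv _ Phase.equivProd

/-- Memory contents as tuples, used only to encode them by numbers. -/
def Memory.equivProd : Memory ≃
    Phase × Option (List ℕ) × List (Option (ℕ × ℕ)) × List ℕ × List (ℕ × ℕ × ℕ) where
  toFun b := (b.phase, b.result, b.pending, b.ans, b.facts)
  invFun p := ⟨p.1, p.2.1, p.2.2.1, p.2.2.2.1, p.2.2.2.2⟩
  left_inv _ := rfl
  right_inv _ := rfl

instance : Primcodable Memory := Primcodable.ofEquiv _ Memory.equivProd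

section Primrec

open Primrec

variable {α β : Type*} [Primcodable α] [Primcodable β]

lemma primrec_box_room : Primrec Box.room := fst.comp (of_equiv (e := Box.equivProd))
lemma primrec_box_baby : Primrec Box.baby :=
  fst.comp (snd.comp (of_equiv (e := Box.equivProd)))
lemma primrec_box_giant : Primrec Box.giant :=
  fst.comp (snd.comp (snd.comp (of_equiv (e := Box.equivProd))))
lemma primrec_box_script : Primrec Box.script :=
  snd.comp (snd.comp (snd.comp (of_equiv (e := Box.equivProd))))

lemma primrec_box_mk {f₁ : α → ℕ} {f₂ f₃ : α → List ℕ} {f₄ : α → List (ℕ × ℕ)}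
    (h₁ : Primrec f₁) (h₂ : Primrec f₂) (h₃ : Primrec f₃) (h₄ : Primrec f₄) :
    Primrec fun a => (⟨f₁ a, f₂ a, f₃ a, f₄ a⟩ : Box) :=
  (of_equiv_symm (e := Box.equivProd)).comp (h₁.pair (h₂.pair (h₃.pair h₄)))

lemma primrec_phase_gens : Primrec Phase.gens := fst.comp (of_equiv (e := Phase.equivProd))
lemma primrec_phase_cur : Primrec Phase.cur :=
  fst.comp (snd.comp (of_equiv (e := Phase.equivProd)))
lemma primrec_phase_bound : Primrec Phase.bound :=
  fst.comp (snd.comp (snd.comp (of_equiv (e := Phase.equivProd))))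
lemma primrec_phase_need : Primrec Phase.need :=
  fst.comp (snd.comp (snd.comp (snd.comp (of_equiv (e := Phase.equivProd)))))
lemma primrec_phase_start : Primrec Phase.start :=
  snd.comp (snd.comp (snd.comp (snd.comp (of_equiv (e := Phase.equivProd)))))

lemma primrec_phase_mk {f₁ : α → List (ℕ × ℕ)} {f₂ f₃ f₄ f₅ : α → ℕ}
    (h₁ : Primrec f₁) (h₂ : Primrec f₂) (h₃ : Primrec f₃) (h₄ : Primrec f₄) (h₅ : Primrec f₅) :
    Primrec fun a => (⟨f₁ a, f₂ a, f₃ a, f₄ a, f₅ a⟩ : Phase) :=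
  (of_equiv_symm (e := Phase.equivProd)).comp (h₁.pair (h₂.pair (h₃.pair (h₄.pair h₅))))

lemma primrec_memory_phase : Primrec Memory.phase :=
  fst.comp (of_equiv (e := Memory.equivProd))
lemma primrec_memory_result : Primrec Memory.result :=
  fst.comp (snd.comp (of_equiv (e := Memory.equivProd)))
lemma primrec_memory_pending : Primrec Memory.pending :=
  fst.comp (snd.comp (snd.comp (of_equiv (e := Memory.equivProd))))
lemma primrec_memory_ans : Primrec Memory.ans :=
  fst.comp (snd.comp (snd.comp (snd.comp (of_equiv (e := Memory.equivProd)))))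
lemma primrec_memory_facts : Primrec Memory.facts :=
  snd.comp (snd.comp (snd.comp (snd.comp (of_equiv (e := Memory.equivProd)))))

lemma primrec_memory_mk {f₁ : α → Phase} {f₂ : α → Option (List ℕ)}
    {f₃ : α → List (Option (ℕ × ℕ))} {f₄ : α → List ℕ} {f₅ : α → List (ℕ × ℕ × ℕ)}
    (h₁ : Primrec f₁) (h₂ : Primrec f₂) (h₃ : Primrec f₃) (h₄ : Primrec f₄) (h₅ : Primrec f₅) :
    Primrec fun a => (⟨f₁ a, f₂ a, f₃ a, f₄ a, f₅ a⟩ : Memory) :=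
  (of_equiv_symm (e := Memory.equivProd)).comp (h₁.pair (h₂.pair (h₃.pair (h₄.pair h₅))))

lemma primrecPred_forall_lt {f : α → ℕ} {R : α → ℕ → Prop} (hf : Primrec f)
    (hR : PrimrecRel R) : PrimrecPred fun a => ∀ i < f a, R a i :=
  (hR.swap.forall_mem_list.comp (list_range.comp hf) Primrec.id).of_eq fun a => by
    simp [Function.swap]

lemma primrecPred_exists_lt {f : α → ℕ} {R : α → ℕ → Prop} (hf : Primrec f)
    (hR : PrimrecRel R) : PrimrecPred fun a => ∃ i < f a, R a i :=
  (hR.swap.exists_mem_list.comp (list_range.comp hf) Primrec.id).of_eq fun a => by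
    simp [Function.swap]

lemma primrecPred_forall_mem {f : α → List β} {R : α → β → Prop} (hf : Primrec f)
    (hR : PrimrecRel R) : PrimrecPred fun a => ∀ i ∈ f a, R a i :=
  hR.swap.forall_mem_list.comp hf Primrec.id

lemma primrec_regs {f g : α → ℕ} (hf : Primrec f) (hg : Primrec g) :
    Primrec fun a => regs (f a) (g a) :=
  list_map (list_range.comp hg) (nat_add.comp (hf.comp fst) snd).to₂

lemma primrec_powTable {L : α → List ℕ} {n s : α → ℕ} (hL : Primrec L) (hn : Primrec n)
    (hs : Primrec s) : Primrec fun a => powTable (L a) (n a) (s a) :=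
  list_append.comp hL (primrec_regs hs (nat_mul.comp hn (list_length.comp hL)))

lemma primrec_powScript {g : α → ℕ} {L : α → List ℕ} {n s : α → ℕ} (hg : Primrec g)
    (hL : Primrec L) (hn : Primrec n) (hs : Primrec s) :
    Primrec fun a => powScript (g a) (L a) (n a) (s a) :=
  list_map (list_take.comp (nat_mul.comp hn (list_length.comp hL)) (primrec_powTable hL hn hs))
    (pair (hg.comp fst) snd).to₂

lemma primrec_getD (d : β) {f : α → List β} {g : α → ℕ} (hf : Primrec f) (hg : Primrec g) :
    Primrec fun a => (f a).getD (g a) d :=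
  (list_getD d).comp hf hg

lemma primrec_prod : Primrec (List.prod : List ℕ → ℕ) :=
  (list_foldr (f := id) (g := fun _ => 1) (h := fun _ p => p.1 * p.2) Primrec.id (const 1)
    (nat_mul.comp (fst.comp snd) (snd.comp snd)).to₂).of_eq fun l => by
      simp [List.prod_eq_foldr]

section Step

variable {b : α → Box} {m g s : α → ℕ}

lemma primrec_babies (hb : Primrec b) (hm : Primrec m) :
    Primrec fun a => (b a).babies (m a) :=
  nat_min.comp hm (primrec_box_room.comp hb)

lemma primrec_giants (hb : Primrec b) (hm : Primrec m) :
    Primrec fun a => (b a).giants (m a) :=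
  nat_div.comp (nat_sub.comp (nat_add.comp hm (primrec_babies hb hm)) (const 1))
    (primrec_babies hb hm)

lemma primrec_step (hs : Primrec s) (hb : Primrec b) (hg : Primrec g) (hm : Primrec m) :
    Primrec fun a => (b a).step (s a) (g a, m a) := by
  have h₁ := nat_sub.comp (primrec_babies hb hm) (const 1)
  have hbaby := primrec_box_baby.comp hb
  have hgiant := primrec_box_giant.comp hb
  have hscript := primrec_box_script.comp hb
  have hN₁ := nat_add.comp hs (list_length.comp hscript)
  have hN₂ := nat_add.comp hN₁ (nat_mul.comp h₁ (list_length.comp hbaby))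
  have hN₃ := nat_add.comp hN₂ h₁
  have hsing := list_cons.comp hg (const [])
  have hstride := primrec_getD 0 (primrec_powTable hsing h₁ hN₂) h₁
  exact primrec_box_mk (nat_div.comp (primrec_box_room.comp hb) (primrec_babies hb hm))
    (primrec_powTable hbaby h₁ hN₁)
    (primrec_regs hN₃ (nat_mul.comp (primrec_giants hb hm) (list_length.comp hgiant)))
    (list_append.comp (list_append.comp (list_append.comp hscript
      (primrec_powScript hg hbaby h₁ hN₁)) (primrec_powScript hg hsing h₁ hN₂))
      (primrec_powScript hstride hgiant (primrec_giants hb hm) hN₃))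

end Step

lemma primrec_box {s t : α → ℕ} {l : α → List (ℕ × ℕ)} (hs : Primrec s) (ht : Primrec t)
    (hl : Primrec l) : Primrec fun a => box (s a) (t a) (l a) :=
  list_foldl hl (primrec_box_mk ht (const [0]) (const [0]) (const []))
    (primrec_step (hs.comp fst) (fst.comp snd) (fst.comp (snd.comp snd))
      (snd.comp (snd.comp snd))).to₂

lemma primrec_groupOrder : Primrec groupOrder :=
  primrec_prod.comp (list_map Primrec.id (snd.comp snd).to₂)

lemma primrec_lower : Primrec Phase.lower :=
  primrec_box primrec_phase_start (nat_sqrt.comp (nat_mul.comp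
    (primrec_groupOrder.comp primrec_phase_gens) primrec_phase_bound)) primrec_phase_gens

lemma primrec_upper : Primrec Phase.upper :=
  primrec_step primrec_phase_start primrec_lower primrec_phase_cur primrec_phase_bound

lemma primrec_relOrder : Primrec₂ Phase.relOrder := by
  classical
  have hcol : PrimrecPred fun x : ((((Phase × List ℕ) × ℕ) × ℕ) × ℕ) =>
      x.1.1.1.2.getD (x.1.1.1.1.upper.baby.getD x.1.2 0) 0 =
        x.1.1.1.2.getD (x.1.1.1.1.upper.giant.getD x.2 0) 0 ∧
      x.1.1.1.1.babies * (x.2 / x.1.1.1.1.lower.giant.length + 1) =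
        x.1.1.2 + 1 + x.1.2 / x.1.1.1.1.lower.baby.length := by
    have hph : Primrec fun x : ((((Phase × List ℕ) × ℕ) × ℕ) × ℕ) => x.1.1.1.1 :=
      fst.comp (fst.comp (fst.comp fst))
    have hans : Primrec fun x : ((((Phase × List ℕ) × ℕ) × ℕ) × ℕ) => x.1.1.1.2 :=
      snd.comp (fst.comp (fst.comp fst))
    have hlow := primrec_lower.comp hph
    have hup := primrec_upper.comp hph
    have hp : Primrec fun x : ((((Phase × List ℕ) × ℕ) × ℕ) × ℕ) => x.1.2 := snd.comp fst
    have hq : Primrec fun x : ((((Phase × List ℕ) × ℕ) × ℕ) × ℕ) => x.2 := snd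
    have hj : Primrec fun x : ((((Phase × List ℕ) × ℕ) × ℕ) × ℕ) => x.1.1.2 :=
      snd.comp (fst.comp fst)
    exact (Primrec.eq.comp (primrec_getD 0 hans (primrec_getD 0 (primrec_box_baby.comp hup) hp))
      (primrec_getD 0 hans (primrec_getD 0 (primrec_box_giant.comp hup) hq))).and
      (Primrec.eq.comp (nat_mul.comp (primrec_babies hlow (primrec_phase_bound.comp hph))
        (succ.comp (nat_div.comp hq (list_length.comp (primrec_box_giant.comp hlow)))))
        (nat_add.comp (succ.comp hj)
          (nat_div.comp hp (list_length.comp (primrec_box_baby.comp hlow)))))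
  have hrel : PrimrecRel fun (x : Phase × List ℕ) (i : ℕ) => x.1.Collision x.2 (i + 1) :=
    (primrecPred_exists_lt (list_length.comp (primrec_box_baby.comp (primrec_upper.comp
      (fst.comp fst)))) (primrecPred_exists_lt (list_length.comp (primrec_box_giant.comp
      (primrec_upper.comp (fst.comp (fst.comp fst))))) hcol.primrecRel).primrecRel).primrecRel
  exact (succ.comp (list_findIdx (list_range.comp (primrec_phase_bound.comp fst))
    hrel.decide)).to₂

lemma primrec_allLists {L : α → List β} {n : α → ℕ} (hL : Primrec L) (hn : Primrec n) :
    Primrec fun a => allLists (L a) (n a) :=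
  nat_rec' hn (const [[]]) (list_flatMap (snd.comp snd)
    (list_map (hL.comp (fst.comp fst)) (list_cons.comp snd (snd.comp fst)).to₂).to₂).to₂

lemma primrecPred_isChart :
    PrimrecPred fun x : (List ℕ × List (ℕ × ℕ × ℕ) × ℕ) × List Character =>
      IsChart x.1.1 x.1.2.1 x.1.2.2 x.2 := by
  refine PrimrecPred.and ?_ (PrimrecPred.and ?_ (PrimrecPred.and ?_ ?_))
  · exact primrecPred_forall_mem snd (nat_le.comp (const 2) (fst.comp snd)).primrecRel
  · have hχ : Primrec fun x : (((List ℕ × List (ℕ × ℕ × ℕ) × ℕ) × List Character) × Character) ×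
      (ℕ × ℕ × ℕ) => x.1.2.2.1 := fst.comp (snd.comp (snd.comp fst))
    have h := Primrec.eq.comp (nat_mod.comp (nat_add.comp (primrec_getD 0 hχ (fst.comp snd))
      (primrec_getD 0 hχ (fst.comp (snd.comp snd)))) (fst.comp (snd.comp fst)))
      (nat_mod.comp (primrec_getD 0 hχ (snd.comp (snd.comp snd))) (fst.comp (snd.comp fst)))
    exact primrecPred_forall_mem snd (PrimrecPred.primrecRel
      (primrecPred_forall_mem (fst.comp (snd.comp (fst.comp fst))) h.primrecRel))
  · exact Primrec.eq.comp (primrec_prod.comp (list_map snd (fst.comp snd).to₂))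
      (snd.comp (snd.comp fst))
  · have hF : Primrec fun x : (((List ℕ × List (ℕ × ℕ × ℕ) × ℕ) × List Character) × ℕ) × ℕ =>
      x.1.1.2 := snd.comp (fst.comp fst)
    have hans : Primrec fun x : (((List ℕ × List (ℕ × ℕ × ℕ) × ℕ) × List Character) × ℕ) × ℕ =>
      x.1.1.1.1 := fst.comp (fst.comp (fst.comp fst))
    have hi : Primrec fun x : (((List ℕ × List (ℕ × ℕ × ℕ) × ℕ) × List Character) × ℕ) × ℕ =>
      x.1.2 := snd.comp fst
    have hfi := primrec_getD default hF hi
    have hfj := primrec_getD default hF snd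
    have hχ := fst.comp (snd.comp hfj)
    have h := Primrec.eq.comp (nat_mod.comp (nat_add.comp
      (primrec_getD 0 hχ (primrec_getD 0 hans (fst.comp (snd.comp (snd.comp hfi)))))
      (primrec_getD 0 hχ (primrec_getD 0 hans (snd.comp (snd.comp (snd.comp hfi))))))
      (fst.comp hfj)) (Primrec.ite (Primrec.eq.comp hi snd) (const 1) (const 0))
    exact primrecPred_forall_lt (list_length.comp snd) (PrimrecPred.primrecRel
      (primrecPred_forall_lt (list_length.comp (snd.comp fst)) h.primrecRel))

lemma primrec_characters {n h : α → ℕ} (hn : Primrec n) (hh : Primrec h) :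
    Primrec fun a => characters (n a) (h a) := by
  have h : Primrec fun x : ((α × ℕ) × List ℕ) × ℕ =>
      (List.range (n x.1.1.1)).map fun b => ((x.1.1.2, x.1.2, x.2, b) : Character) :=
    list_map (list_range.comp (hn.comp (fst.comp (fst.comp fst))))
      (pair (snd.comp (fst.comp (fst.comp fst))) (pair (snd.comp (fst.comp fst))
        (pair (snd.comp fst) snd))).to₂
  have h' : Primrec fun x : (α × ℕ) × List ℕ => (List.range (n x.1.1)).flatMap fun a =>
      (List.range (n x.1.1)).map fun b => ((x.1.2, x.2, a, b) : Character) :=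
    list_flatMap (list_range.comp (hn.comp (fst.comp fst))) h.to₂
  exact list_flatMap (list_range.comp (succ.comp hh)) (list_flatMap (primrec_allLists
    (list_range.comp (hh.comp fst)) (hn.comp fst)) h'.to₂).to₂

lemma primrec_charts {n h : α → ℕ} (hn : Primrec n) (hh : Primrec h) :
    Primrec fun a => charts (n a) (h a) :=
  list_flatMap (list_range.comp hh)
    (primrec_allLists (primrec_characters (hn.comp fst) (hh.comp fst)) snd).to₂

lemma primrec_findChart :
    Primrec fun x : List ℕ × List (ℕ × ℕ × ℕ) × ℕ => findChart x.1 x.2.1 x.2.2 := by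
  classical
  have h := primrec_charts (list_length.comp (fst (α := List ℕ) (β := List (ℕ × ℕ × ℕ) × ℕ)))
    (snd.comp snd)
  exact primrec_getD [] h (list_findIdx h primrecPred_isChart.primrecRel.decide)

lemma primrec_pow : Primrec₂ ((· ^ ·) : ℕ → ℕ → ℕ) :=
  Primrec₂.unpaired'.1 Nat.Primrec.pow

lemma primrec_bits : Primrec bits :=
  list_findIdx (list_range.comp succ)
    (nat_le.comp fst (primrec_pow.comp (const 2) snd)).primrecRel.decide

lemma primrec_trials (c : ℕ) : Primrec (trials c) :=
  nat_mul.comp (const (c + 1)) (succ.comp primrec_bits)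

section Memory

variable {gens : α → List (ℕ × ℕ)} {need : α → ℕ} {ph : α → Phase} {ans : α → List ℕ}
  {facts : α → List (ℕ × ℕ × ℕ)}

lemma primrec_script (hph : Primrec ph) :
    Primrec fun a => (ph a).upper.script.map some :=
  list_map (primrec_box_script.comp (primrec_upper.comp hph)) (option_some.comp snd).to₂

lemma primrec_begin (hg : Primrec gens) (hn : Primrec need) (ha : Primrec ans)
    (hf : Primrec facts) : Primrec fun a => begin (gens a) (need a) (ans a) (facts a) :=
  have hph := primrec_phase_mk hg (list_length.comp ha) (const 1) hn
    (succ.comp (list_length.comp ha))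
  primrec_memory_mk hph (const none) (list_cons.comp (const none) (primrec_script hph)) ha hf

lemma primrec_widen (hp : Primrec ph) (ha : Primrec ans) (hf : Primrec facts) :
    Primrec fun a => widen (ph a) (ans a) (facts a) :=
  have hph := primrec_phase_mk (primrec_phase_gens.comp hp) (primrec_phase_cur.comp hp)
    (nat_mul.comp (const 2) (primrec_phase_bound.comp hp)) (primrec_phase_need.comp hp)
    (list_length.comp ha)
  primrec_memory_mk hph (const none) (primrec_script hph) ha hf

lemma primrec_finish (hp : Primrec ph) (ha : Primrec ans) (hf : Primrec facts) :
    Primrec fun a => finish (ph a) (ans a) (facts a) :=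
  have hF := primrec_findChart.comp (ha.pair (hf.pair
    (primrec_groupOrder.comp (primrec_phase_gens.comp hp))))
  primrec_memory_mk hp (option_some.comp (primrec_regs (list_length.comp ha)
    (list_length.comp hF))) (list_map hF (option_some.comp (snd.comp (snd.comp snd))).to₂) ha hf

end Memory

lemma primrec_plan (c : ℕ) : Primrec (plan c) := by
  have hp := primrec_memory_phase
  have ha := primrec_memory_ans
  have hf := primrec_memory_facts
  have hg := primrec_phase_gens.comp hp
  have hr := primrec_relOrder.comp hp ha
  have hn := primrec_phase_need.comp hp
  exact Primrec.ite (nat_lt.comp (primrec_phase_bound.comp hp) hr) (primrec_widen hp ha hf)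
    (Primrec.ite (Primrec.eq.comp hr (const 1)) (Primrec.ite (nat_le.comp hn (const 1))
      (primrec_finish hp ha hf) (primrec_begin hg (nat_sub.comp hn (const 1)) ha hf))
      (primrec_begin (list_append.comp hg (list_cons.comp
        (pair (primrec_phase_cur.comp hp) hr) (const [])))
        ((primrec_trials c).comp (nat_mul.comp (primrec_groupOrder.comp hg) hr)) ha hf))

lemma primrec_record : Primrec₂ record := by
  have hp := primrec_memory_pending.comp (fst (α := Memory) (β := ℕ))
  have ha := primrec_memory_ans.comp (fst (α := Memory) (β := ℕ))
  refine primrec_memory_mk (primrec_memory_phase.comp fst) (primrec_memory_result.comp fst)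
    (list_tail.comp hp) (list_concat.comp ha snd)
    (list_append.comp (primrec_memory_facts.comp fst) (optionToList.comp
      (option_map (list_headI.comp hp) ?_)))
  exact (pair (primrec_getD 0 (ha.comp fst) (fst.comp snd))
    (pair (primrec_getD 0 (ha.comp fst) (snd.comp snd)) (snd.comp fst))).to₂

lemma primrec_update (c : ℕ) : Primrec₂ (update c) := by
  classical
  have h : Primrec fun x : Memory × ℕ => record x.1 x.2 := primrec_record
  exact (Primrec.ite ((Primrec.eq.comp (primrec_memory_pending.comp h) (const [])).and
    (Primrec.eq.comp (primrec_memory_result.comp h) (const none)))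
    ((primrec_plan c).comp h) h).of_eq fun x => rfl

lemma primrec_move : Primrec move := by
  have hmk : Primrec Action.equivSum.symm := of_equiv_symm (e := Action.equivSum)
  have hout : Primrec fun m : Memory => Action.output (m.result.getD []) :=
    hmk.comp (sumInr.comp (option_getD.comp primrec_memory_result (const [])))
  have hmul : Primrec fun ij : ℕ × ℕ => Action.mul ij.1 ij.2 :=
    hmk.comp (sumInl.comp (sumInr.comp Primrec.id))
  have hmv : Primrec₂ fun (_ : Memory) (o : Option (ℕ × ℕ)) =>
      (Option.casesOn o Action.sample fun ij => Action.mul ij.1 ij.2 : Action) :=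
    (option_casesOn (o := fun x : Memory × Option (ℕ × ℕ) => x.2) snd (const Action.sample)
      (hmul.comp snd).to₂).to₂
  refine (option_casesOn (list_head?.comp primrec_memory_pending) hout hmv).of_eq fun m => ?_
  unfold move
  rcases m.pending.head? with _ | _ | _ <;> rfl

end Primrec

/-- The algorithm; `c` is the exponent in the bound for its failure probability. -/
noncomputable def algorithm (c : ℕ) : Algorithm where
  Mem := Memory
  init := begin [] (trials c 1) [] []
  act := move
  upd := update c
  act_computable := primrec_move.to_comp
  upd_computable := (primrec_update c).to_comp

/-! ### Baby steps and giant steps -/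

/-- The register contents `κ` satisfy the multiplications of a script that fills the registers from
`start` on. -/
def Obeys {K : Type*} [Mul K] (κ : ℕ → K) (start : ℕ) (sc : List (ℕ × ℕ)) : Prop :=
  ∀ (t : ℕ) (ht : t < sc.length), κ (start + t) = κ sc[t].1 * κ sc[t].2

lemma obeys_append {K : Type*} [Mul K] {κ : ℕ → K} {start : ℕ} {a b : List (ℕ × ℕ)} :
    Obeys κ start (a ++ b) ↔ Obeys κ start a ∧ Obeys κ (start + a.length) b := by
  constructor
  · intro h
    refine ⟨fun t ht => ?_, fun t ht => ?_⟩
    · have := h t (by simp; omega)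
      rwa [List.getElem_append_left ht] at this
    · have := h (a.length + t) (by simp; omega)
      rw [List.getElem_append_right (by omega)] at this
      simpa [add_assoc] using this
  · rintro ⟨h₁, h₂⟩ t ht
    by_cases hta : t < a.length
    · rw [List.getElem_append_left hta]
      exact h₁ t hta
    · rw [List.getElem_append_right (by omega)]
      have := h₂ (t - a.length) (by simp at ht; omega)
      rwa [show start + a.length + (t - a.length) = start + t by omega] at this

@[simp] lemma length_regs (s n : ℕ) : (regs s n).length = n := by simp [regs]

@[simp] lemma getElem_regs (s n i : ℕ) (h : i < (regs s n).length) : (regs s n)[i] = s + i := by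
  simp [regs]

@[simp] lemma mem_regs {s n i : ℕ} : i ∈ regs s n ↔ s ≤ i ∧ i < s + n := by
  simp only [regs, List.mem_map, List.mem_range]
  constructor
  · rintro ⟨a, h, rfl⟩
    omega
  · intro h
    exact ⟨i - s, by omega, by omega⟩

@[simp] lemma length_powTable (L : List ℕ) (n s : ℕ) :
    (powTable L n s).length = (n + 1) * L.length := by
  simp [powTable]; ring

@[simp] lemma length_powScript (g : ℕ) (L : List ℕ) (n s : ℕ) :
    (powScript g L n s).length = n * L.length := by
  simp [powScript]

lemma powTable_getD_of_le {L : List ℕ} {n s p : ℕ} (h : L.length ≤ p)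
    (hp : p < (n + 1) * L.length) : (powTable L n s).getD p 0 = s + (p - L.length) := by
  have : p < (powTable L n s).length := by simpa using hp
  rw [List.getD_eq_getElem _ _ this]
  simp only [powTable]
  rw [List.getElem_append_right h, getElem_regs]

lemma powTable_getD_of_lt {L : List ℕ} {n s p : ℕ} (h : p < L.length) :
    (powTable L n s).getD p 0 = L.getD p 0 := by
  rw [powTable, List.getD_append _ _ _ _ h]

/-- The entries of the table of powers. -/
lemma Obeys.powTable {K : Type*} [CommGroup K] {κ : ℕ → K} {g n s : ℕ} {L : List ℕ}
    (h : Obeys κ s (powScript g L n s)) (p : ℕ) (hp : p < (n + 1) * L.length) :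
    κ ((powTable L n s).getD p 0) = κ g ^ (p / L.length) * κ (L.getD (p % L.length) 0) := by
  induction p using Nat.strong_induction_on with
  | _ p ih =>
    by_cases hpL : p < L.length
    · rw [powTable_getD_of_lt hpL, Nat.div_eq_of_lt hpL, Nat.mod_eq_of_lt hpL, pow_zero, one_mul]
    · push Not at hpL
      have hL : 0 < L.length := by
        rcases Nat.eq_zero_or_pos L.length with h0 | h0
        · simp [h0] at hp
        · exact h0
      have hlt : p - L.length < n * L.length := by
        have : (n + 1) * L.length = n * L.length + L.length := by ring
        omega
      have ht := h (p - L.length) (by simpa using hlt)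
      rw [powTable_getD_of_le hpL hp, ht]
      have hget : (powScript g L n s)[p - L.length]'(by simpa using hlt) =
          (g, (BasisSearch.powTable L n s).getD (p - L.length) 0) := by
        have : p - L.length < (BasisSearch.powTable L n s).length := by
          simp; omega
        simp [powScript, List.getElem?_eq_getElem this]
      rw [hget, ih (p - L.length) (by omega) (by omega)]
      have hdiv : p / L.length = (p - L.length) / L.length + 1 := Nat.div_eq_sub_div hL hpL
      have hmod : p % L.length = (p - L.length) % L.length := Nat.mod_eq_sub_mod hpL
      rw [hdiv, hmod, pow_succ]
      rw [mul_comm (κ g ^ _) (κ g), mul_assoc]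

section Step

variable {b : Box} {m : ℕ}

lemma Box.babies_pos (hm : 1 ≤ m) (hb : 1 ≤ b.room) : 1 ≤ b.babies m := le_min hm hb

lemma Box.le_babies_mul_giants (hm : 1 ≤ m) (hb : 1 ≤ b.room) :
    m ≤ b.babies m * b.giants m := by
  have hs := Box.babies_pos hm hb
  have := Nat.div_add_mod (m + b.babies m - 1) (b.babies m)
  have := Nat.mod_lt (m + b.babies m - 1) hs
  unfold Box.giants
  omega

lemma Box.giants_pos (hm : 1 ≤ m) (hb : 1 ≤ b.room) : 1 ≤ b.giants m := by
  have := Box.le_babies_mul_giants hm hb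
  by_contra h
  have h0 : b.giants m = 0 := by omega
  simp [h0] at this
  omega

lemma Box.length_baby_step (start g : ℕ) (hm : 1 ≤ m) (hb : 1 ≤ b.room) :
    (b.step start (g, m)).baby.length = b.babies m * b.baby.length := by
  have := Box.babies_pos hm hb
  simp [Box.step, Nat.sub_add_cancel this]

lemma Box.length_giant_step (start g : ℕ) :
    (b.step start (g, m)).giant.length = b.giants m * b.giant.length := by
  simp [Box.step]

lemma Box.room_step_pos (start g : ℕ) (hm : 1 ≤ m) (hb : 1 ≤ b.room) :
    1 ≤ (b.step start (g, m)).room :=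
  (Nat.one_le_div_iff (Box.babies_pos hm hb)).2 (min_le_right _ _)

variable {K : Type*} [CommGroup K] {κ : ℕ → K} {start g : ℕ}

lemma Box.step_baby (hm : 1 ≤ m) (hb : 1 ≤ b.room)
    (h : Obeys κ start (b.step start (g, m)).script) (p : ℕ)
    (hp : p < b.babies m * b.baby.length) :
    κ ((b.step start (g, m)).baby.getD p 0) =
      κ g ^ (p / b.baby.length) * κ (b.baby.getD (p % b.baby.length) 0) := by
  simp only [Box.step, obeys_append] at h
  exact h.1.1.2.powTable p (by rwa [Nat.sub_add_cancel (Box.babies_pos hm hb)])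

lemma Box.stride_value (hm : 1 ≤ m) (hb : 1 ≤ b.room)
    (h : Obeys κ start (b.step start (g, m)).script) :
    κ (b.stride start (g, m)) = κ g ^ b.babies m := by
  have hs := Box.babies_pos hm hb
  simp only [Box.step, obeys_append, List.length_append, length_powScript, ← add_assoc] at h
  have := h.1.2.powTable (b.babies m - 1) (by simp)
  rw [Box.stride, this]
  simp only [List.length_singleton, Nat.div_one, Nat.mod_one, List.getD_cons_zero]
  rw [← pow_succ, Nat.sub_add_cancel hs]

lemma Box.step_giant (hm : 1 ≤ m) (hb : 1 ≤ b.room)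
    (h : Obeys κ start (b.step start (g, m)).script) (q : ℕ)
    (hq : q < b.giants m * b.giant.length) :
    κ ((b.step start (g, m)).giant.getD q 0) =
      κ g ^ (b.babies m * (q / b.giant.length + 1)) *
        κ (b.giant.getD (q % b.giant.length) 0) := by
  have hst := Box.stride_value hm hb h
  have hv := Box.giants_pos hm hb
  have hL : 0 < b.giant.length := by
    rcases Nat.eq_zero_or_pos b.giant.length with h0 | h0
    · simp [h0] at hq
    · exact h0
  simp only [Box.step, obeys_append, List.length_append, length_powScript, ← add_assoc,
    List.length_singleton, mul_one] at h
  -- The new giant steps are the entries of a table of powers without its first part.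
  have hq' : q + b.giant.length < (b.giants m + 1) * b.giant.length := by
    have : (b.giants m + 1) * b.giant.length = b.giants m * b.giant.length + b.giant.length := by
      ring
    omega
  have := h.2.powTable (q + b.giant.length) hq'
  rw [powTable_getD_of_le (by omega) hq', Nat.add_sub_cancel, Nat.add_div_right _ hL,
    Nat.add_mod_right, hst, ← pow_mul] at this
  simp only [Box.step]
  rw [List.getD_eq_getElem _ _ (by simpa using hq), getElem_regs]
  exact this

end Step

/-- Both tables lie in the coset of `S` of the element in register `0`. -/
def Box.Inside {K : Type*} [CommGroup K] (κ : ℕ → K) (S : Subgroup K) (b : Box) : Prop :=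
  (∀ i ∈ b.baby, κ i / κ 0 ∈ S) ∧ ∀ i ∈ b.giant, κ i / κ 0 ∈ S

lemma Box.inside_step {K : Type*} [CommGroup K] {κ : ℕ → K} {S : Subgroup K} {b : Box}
    {start g m : ℕ} (hm : 1 ≤ m) (hb : 1 ≤ b.room) (hin : b.Inside κ S) (hg : κ g ∈ S)
    (h : Obeys κ start (b.step start (g, m)).script) :
    (b.step start (g, m)).Inside κ S := by
  constructor
  · intro i hi
    obtain ⟨p, hp, rfl⟩ := List.mem_iff_getElem.1 hi
    have hp' := hp
    rw [Box.length_baby_step start g hm hb] at hp'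
    have hL : 0 < b.baby.length := by
      rcases Nat.eq_zero_or_pos b.baby.length with h0 | h0
      · simp [h0] at hp'
      · exact h0
    have := Box.step_baby hm hb h p hp'
    rw [List.getD_eq_getElem _ _ hp] at this
    rw [this, mul_div_assoc]
    refine S.mul_mem (S.pow_mem hg _) (hin.1 _ ?_)
    rw [List.getD_eq_getElem _ _ (Nat.mod_lt _ hL)]
    exact List.getElem_mem _
  · intro i hi
    obtain ⟨p, hp, rfl⟩ := List.mem_iff_getElem.1 hi
    have hp' := hp
    rw [Box.length_giant_step start g] at hp'
    have hL : 0 < b.giant.length := by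
      rcases Nat.eq_zero_or_pos b.giant.length with h0 | h0
      · simp [h0] at hp'
      · exact h0
    have := Box.step_giant hm hb h p hp'
    rw [List.getD_eq_getElem _ _ hp] at this
    rw [this, mul_div_assoc]
    refine S.mul_mem (S.pow_mem hg _) (hin.2 _ ?_)
    rw [List.getD_eq_getElem _ _ (Nat.mod_lt _ hL)]
    exact List.getElem_mem _

/-- Every element `x` of `H` is a quotient of a baby step and a giant step, and every `x * κ 0 ^ 2`
is a product of a baby step and a giant step. -/
def Box.Covers {K : Type*} [CommGroup K] (κ : ℕ → K) (H : Subgroup K) (b : Box) : Prop :=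
  ∀ x ∈ H, (∃ i ∈ b.baby, ∃ j ∈ b.giant, κ i = x * κ j) ∧
    ∃ i ∈ b.baby, ∃ j ∈ b.giant, κ i * κ j = x * κ 0 ^ 2

section Covers

variable {K : Type*} [CommGroup K] {κ : ℕ → K} {H : Subgroup K} {b : Box} {start g m : ℕ}

lemma Box.exists_baby (hm : 1 ≤ m) (hb : 1 ≤ b.room)
    (h : Obeys κ start (b.step start (g, m)).script) {u i : ℕ} (hu : u < b.babies m)
    (hi : i ∈ b.baby) :
    ∃ p < (b.step start (g, m)).baby.length, p / b.baby.length = u ∧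
      κ ((b.step start (g, m)).baby.getD p 0) = κ g ^ u * κ i := by
  obtain ⟨k, hk, rfl⟩ := List.mem_iff_getElem.1 hi
  have hp : b.baby.length * u + k < b.babies m * b.baby.length := by nlinarith
  have hdiv : (b.baby.length * u + k) / b.baby.length = u := by
    rw [Nat.mul_add_div (by omega), Nat.div_eq_of_lt hk, add_zero]
  refine ⟨b.baby.length * u + k, by rwa [Box.length_baby_step start g hm hb], hdiv, ?_⟩
  rw [Box.step_baby hm hb h _ hp, hdiv, Nat.mul_add_mod, Nat.mod_eq_of_lt hk,
    List.getD_eq_getElem _ _ hk]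

lemma Box.exists_giant (hm : 1 ≤ m) (hb : 1 ≤ b.room)
    (h : Obeys κ start (b.step start (g, m)).script) {w i : ℕ} (hw : w < b.giants m)
    (hi : i ∈ b.giant) :
    ∃ q < (b.step start (g, m)).giant.length, q / b.giant.length = w ∧
      κ ((b.step start (g, m)).giant.getD q 0) = κ g ^ (b.babies m * (w + 1)) * κ i := by
  obtain ⟨k, hk, rfl⟩ := List.mem_iff_getElem.1 hi
  have hp : b.giant.length * w + k < b.giants m * b.giant.length := by nlinarith
  have hdiv : (b.giant.length * w + k) / b.giant.length = w := by
    rw [Nat.mul_add_div (by omega), Nat.div_eq_of_lt hk, add_zero]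
  refine ⟨b.giant.length * w + k, by rwa [Box.length_giant_step start g], hdiv, ?_⟩
  rw [Box.step_giant hm hb h _ hp, hdiv, Nat.mul_add_mod, Nat.mod_eq_of_lt hk,
    List.getD_eq_getElem _ _ hk]

/-- An element of the subgroup generated by `H` and `g` is `g ^ e` times an element of `H`, where `e`
can be shifted by multiples of the order `m` of `g` modulo `H`. -/
lemma exists_pow_mul {x g : K} (hx : x ∈ H ⊔ Subgroup.zpowers g) (hm : 1 ≤ m) (hg : g ^ m ∈ H) :
    ∃ e < m, ∃ y ∈ H, x = g ^ e * y := by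
  obtain ⟨y, hy, z, hz, rfl⟩ := Subgroup.mem_sup.1 hx
  obtain ⟨i, rfl⟩ := Subgroup.mem_zpowers_iff.1 hz
  have hm0 : (m : ℤ) ≠ 0 := by omega
  refine ⟨(i % m).toNat, ?_, g ^ ((m : ℤ) * (i / m)) * y, H.mul_mem ?_ hy, ?_⟩
  · have := Int.emod_lt_of_pos i (show (0 : ℤ) < m by omega)
    omega
  · rw [zpow_mul, zpow_natCast]
    exact H.zpow_mem hg _
  · rw [← zpow_natCast, Int.toNat_of_nonneg (Int.emod_nonneg i hm0), ← mul_assoc, ← zpow_add,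
      Int.emod_add_mul_ediv, mul_comm]

lemma Box.covers_step (hm : 1 ≤ m) (hb : 1 ≤ b.room) (hc : b.Covers κ H) (hg : κ g ^ m ∈ H)
    (h : Obeys κ start (b.step start (g, m)).script) :
    (b.step start (g, m)).Covers κ (H ⊔ Subgroup.zpowers (κ g)) := by
  have hs := Box.babies_pos hm hb
  have hsv := Box.le_babies_mul_giants hm hb
  have hmem : ∀ {L : List ℕ} {p : ℕ}, p < L.length → L.getD p 0 ∈ L := fun {L p} hp => by
    rw [List.getD_eq_getElem _ _ hp]
    exact List.getElem_mem _
  set s := b.babies m with hsdef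
  set H' := H ⊔ Subgroup.zpowers (κ g)
  have hgH' : κ g ∈ H' := Subgroup.mem_sup_right (Subgroup.mem_zpowers _)
  have hsplit : ∀ e < m, e % s < s ∧ e / s < b.giants m := fun e he =>
    ⟨Nat.mod_lt _ hs, Nat.div_lt_of_lt_mul (by omega)⟩
  intro x hx
  constructor
  · -- `x⁻¹ = g ^ (1 + e) * y⁻¹`, and `1 + e = s * (w + 1) - u`.
    obtain ⟨e, he, y, hy, hxe⟩ := exists_pow_mul (m := m)
      (H'.mul_mem (H'.inv_mem hx) (H'.inv_mem hgH')) hm hg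
    obtain ⟨h₁, h₂⟩ := hsplit e he
    obtain ⟨i, hi, j, hj, hij⟩ := (hc y⁻¹ (H.inv_mem hy)).1
    obtain ⟨p, hp, -, hpv⟩ := Box.exists_baby hm hb h (u := s - 1 - e % s) (by omega) hi
    obtain ⟨q, hq, -, hqv⟩ := Box.exists_giant hm hb h h₂ hj
    refine ⟨_, hmem hp, _, hmem hq, ?_⟩
    have hx' : x = (κ g ^ (e + 1) * y)⁻¹ := by
      rw [pow_succ, mul_right_comm, ← hxe]
      group
    have hexp : s * (e / s + 1) = (s - 1 - e % s) + (e + 1) := by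
      have := Nat.div_add_mod e s
      rw [mul_add]
      omega
    rw [hpv, hqv, hij, hx', ← hsdef, hexp, pow_add (κ g) (s - 1 - e % s), mul_inv]
    rw [eq_comm, mul_comm (κ g ^ (e + 1))⁻¹]
    calc y⁻¹ * (κ g ^ (e + 1))⁻¹ * (κ g ^ (s - 1 - e % s) * κ g ^ (e + 1) * κ j)
        = (κ g ^ (e + 1))⁻¹ * κ g ^ (e + 1) * (κ g ^ (s - 1 - e % s) * (y⁻¹ * κ j)) := by
          ac_rfl
      _ = _ := by rw [inv_mul_cancel, one_mul]
  · obtain ⟨e, he, y, hy, hxe⟩ := exists_pow_mul (m := m)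
      (H'.mul_mem hx (H'.inv_mem (H'.pow_mem hgH' s))) hm hg
    obtain ⟨h₁, h₂⟩ := hsplit e he
    obtain ⟨i, hi, j, hj, hij⟩ := (hc y hy).2
    obtain ⟨p, hp, -, hpv⟩ := Box.exists_baby hm hb h h₁ hi
    obtain ⟨q, hq, -, hqv⟩ := Box.exists_giant hm hb h h₂ hj
    refine ⟨_, hmem hp, _, hmem hq, ?_⟩
    have hx' : x = κ g ^ s * (κ g ^ e * y) := by
      rw [← hxe, mul_comm x, mul_inv_cancel_left]
    have hexp : e % s + s * (e / s + 1) = s + e := by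
      have := Nat.div_add_mod e s
      rw [mul_add]
      omega
    rw [hpv, hqv, hx', ← hsdef]
    calc κ g ^ (e % s) * κ i * (κ g ^ (s * (e / s + 1)) * κ j)
        = κ g ^ (e % s) * κ g ^ (s * (e / s + 1)) * (κ i * κ j) := by ac_rfl
      _ = _ := by rw [← pow_add, hexp, hij, pow_add]; ac_rfl

/-- If `g ^ j` lies in `H` and `j` is in the range of the search, then a baby step meets a giant step
at distance `j`. -/
lemma Box.exists_collision (hm : 1 ≤ m) (hb : 1 ≤ b.room) (hc : b.Covers κ H)
    (h : Obeys κ start (b.step start (g, m)).script) {j : ℕ} (hj : 1 ≤ j) (hjm : j ≤ m)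
    (hg : κ g ^ j ∈ H) :
    ∃ p < (b.step start (g, m)).baby.length, ∃ q < (b.step start (g, m)).giant.length,
      κ ((b.step start (g, m)).baby.getD p 0) = κ ((b.step start (g, m)).giant.getD q 0) ∧
        b.babies m * (q / b.giant.length + 1) = j + p / b.baby.length := by
  have hs := Box.babies_pos hm hb
  have hsv := Box.le_babies_mul_giants hm hb
  set s := b.babies m with hsdef
  obtain ⟨i, hi, k, hk, hik⟩ := (hc _ hg).1
  have h₁ : (j - 1) % s < s := Nat.mod_lt _ hs
  have h₂ : (j - 1) / s < b.giants m := Nat.div_lt_of_lt_mul (by omega)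
  obtain ⟨p, hp, hpu, hpv⟩ := Box.exists_baby hm hb h (u := s - 1 - (j - 1) % s) (by omega) hi
  obtain ⟨q, hq, hqw, hqv⟩ := Box.exists_giant hm hb h h₂ hk
  have hexp : s * ((j - 1) / s + 1) = j + (s - 1 - (j - 1) % s) := by
    have := Nat.div_add_mod (j - 1) s
    rw [mul_add]
    omega
  refine ⟨p, hp, q, hq, ?_, ?_⟩
  · rw [hpv, hqv, hik, ← hsdef, hexp, pow_add]
    ac_rfl
  · rw [hpu, hqw, hexp]

/-- If a baby step meets a giant step at distance `j`, then `g ^ j` lies in `H`. -/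
lemma Box.pow_mem_of_collision (hm : 1 ≤ m) (hb : 1 ≤ b.room) (hin : b.Inside κ H)
    (h : Obeys κ start (b.step start (g, m)).script) {j p q : ℕ}
    (hp : p < (b.step start (g, m)).baby.length) (hq : q < (b.step start (g, m)).giant.length)
    (heq : κ ((b.step start (g, m)).baby.getD p 0) = κ ((b.step start (g, m)).giant.getD q 0))
    (hj : b.babies m * (q / b.giant.length + 1) = j + p / b.baby.length) : κ g ^ j ∈ H := by
  have hmem : ∀ (L : List ℕ) (p n : ℕ), p < n * L.length → L.getD (p % L.length) 0 ∈ L := by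
    intro L p n hp
    have hL : 0 < L.length := by
      rcases Nat.eq_zero_or_pos L.length with h0 | h0
      · simp [h0] at hp
      · exact h0
    rw [List.getD_eq_getElem _ _ (Nat.mod_lt _ hL)]
    exact List.getElem_mem _
  rw [Box.length_baby_step start g hm hb] at hp
  rw [Box.length_giant_step start g] at hq
  have h₁ := hin.1 _ (hmem _ _ _ hp)
  have h₂ := hin.2 _ (hmem _ _ _ hq)
  rw [Box.step_baby hm hb h p hp, Box.step_giant hm hb h q hq, hj, pow_add] at heq
  have h₃ := H.div_mem h₁ h₂
  rw [div_div_div_cancel_right] at h₃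
  convert h₃ using 1
  rw [eq_div_iff_mul_eq']
  exact mul_left_cancel ((heq.trans (by ac_rfl) : κ g ^ (p / b.baby.length) * _ =
    κ g ^ (p / b.baby.length) * _).symm)

end Covers

/-! ### Size and validity of the tables -/

/-- Every multiplication of the script refers to registers that are filled before it. -/
def Valid (start : ℕ) (sc : List (ℕ × ℕ)) : Prop :=
  ∀ (t : ℕ) (ht : t < sc.length), sc[t].1 < start + t ∧ sc[t].2 < start + t

lemma Valid.append {start : ℕ} {a b : List (ℕ × ℕ)} (ha : Valid start a)
    (hb : Valid (start + a.length) b) : Valid start (a ++ b) := by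
  intro t ht
  by_cases hta : t < a.length
  · rw [List.getElem_append_left hta]
    exact ha t hta
  · rw [List.getElem_append_right (by omega)]
    have := hb (t - a.length) (by simp at ht; omega)
    rwa [show start + a.length + (t - a.length) = start + t by omega] at this

lemma valid_powScript {g n s : ℕ} {L : List ℕ} (hg : g < s) (hL : ∀ i ∈ L, i < s) :
    Valid s (powScript g L n s) := by
  intro t ht
  have ht' : t < n * L.length := by simpa using ht
  have hlt : t < (powTable L n s).length := by
    rw [length_powTable]; nlinarith
  have hget : (powScript g L n s)[t] = (g, (powTable L n s).getD t 0) := by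
    simp [powScript, List.getElem?_eq_getElem hlt]
  rw [hget]
  refine ⟨by simp; omega, ?_⟩
  by_cases h : t < L.length
  · simp only [powTable_getD_of_lt h, List.getD_eq_getElem _ _ h]
    have := hL _ (List.getElem_mem h)
    omega
  · simp only [powTable_getD_of_le (not_lt.1 h) (by simpa using hlt)]
    have : 0 < L.length := by
      rcases Nat.eq_zero_or_pos L.length with h0 | h0
      · simp [h0] at ht'
      · exact h0
    omega

/-- The registers of the tables are filled by the script, or before it. -/
def Box.Bounded (start : ℕ) (b : Box) : Prop :=
  Valid start b.script ∧ (∀ i ∈ b.baby, i < start + b.script.length) ∧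
    ∀ i ∈ b.giant, i < start + b.script.length

lemma Box.bounded_step {b : Box} {start g m : ℕ} (hm : 1 ≤ m) (hr : 1 ≤ b.room)
    (hb : b.Bounded start) (hg : g < start) : (b.step start (g, m)).Bounded start := by
  obtain ⟨h₁, h₂, h₃⟩ := hb
  have hs := Box.babies_pos hm hr
  have hstride : b.stride start (g, m) <
      start + b.script.length + (b.babies m - 1) * b.baby.length + (b.babies m - 1) := by
    unfold Box.stride
    simp only
    rcases Nat.lt_or_ge (b.babies m - 1) 1 with h | h
    · have h0 : b.babies m - 1 = 0 := by omega
      rw [h0, powTable_getD_of_lt (by simp)]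
      simp; omega
    · rw [powTable_getD_of_le (by simpa using h) (by simp)]
      simp; omega
  refine ⟨?_, ?_, ?_⟩
  · simp only [Box.step]
    refine Valid.append (Valid.append (Valid.append h₁ ?_) ?_) ?_
    · exact valid_powScript (by omega) h₂
    · simp only [List.length_append, length_powScript, ← add_assoc]
      exact valid_powScript (by omega) (by simp; omega)
    · simp only [List.length_append, length_powScript, ← add_assoc, List.length_singleton,
        mul_one]
      exact valid_powScript hstride fun i hi => by have := h₃ i hi; omega
  · intro i hi
    simp only [Box.step, List.length_append, length_powScript, powTable, List.mem_append,
      mem_regs] at hi ⊢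
    rcases hi with hi | hi
    · have := h₂ i hi; omega
    · omega
  · intro i hi
    simp only [Box.step, List.length_append, length_powScript, mem_regs,
      List.length_singleton] at hi ⊢
    omega

lemma box_append (start room : ℕ) (l : List (ℕ × ℕ)) (gm : ℕ × ℕ) :
    box start room (l ++ [gm]) = (box start room l).step start gm := by
  simp [box]

section Box

variable {start room : ℕ} {l : List (ℕ × ℕ)}

lemma one_le_room_box (hr : 1 ≤ room) (hl : ∀ gm ∈ l, 1 ≤ gm.2) :
    1 ≤ (box start room l).room := by
  induction l using List.reverseRecOn with
  | nil => simpa [box]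
  | append_singleton l gm ih =>
    rw [box_append]
    exact Box.room_step_pos start gm.1 (hl gm (by simp)) (ih fun x hx => hl x (by simp [hx]))

lemma bounded_box (hr : 1 ≤ room) (hl : ∀ gm ∈ l, 1 ≤ gm.2) (hs : 0 < start)
    (hg : ∀ gm ∈ l, gm.1 < start) : (box start room l).Bounded start := by
  induction l using List.reverseRecOn with
  | nil =>
    refine ⟨fun t ht => by simp [box] at ht, ?_, ?_⟩ <;> simpa [box]
  | append_singleton l gm ih =>
    rw [box_append]
    have hl' : ∀ x ∈ l, 1 ≤ x.2 := fun x hx => hl x (by simp [hx])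
    exact Box.bounded_step (hl gm (by simp)) (one_le_room_box hr hl')
      (ih hl' fun x hx => hg x (by simp [hx])) (hg gm (by simp))

end Box

lemma Box.room_mul_baby_le (start : ℕ) (l : List (ℕ × ℕ)) (hl : ∀ gm ∈ l, 1 ≤ gm.2) (b : Box)
    (hb : 1 ≤ b.room) : (l.foldl (Box.step start) b).baby.length ≤ b.room * b.baby.length := by
  induction l generalizing b with
  | nil => simpa using Nat.le_mul_of_pos_left _ hb
  | cons gm l ih =>
    have hm := hl gm (by simp)
    refine (ih (fun x hx => hl x (by simp [hx])) _ (Box.room_step_pos start gm.1 hm hb)).trans ?_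
    rw [show gm = (gm.1, gm.2) from rfl, Box.length_baby_step _ _ hm hb, ← mul_assoc]
    exact Nat.mul_le_mul_right _ (Nat.div_mul_le_self _ _)

lemma Box.length_giant_of_room (start : ℕ) (l : List (ℕ × ℕ)) (hl : ∀ gm ∈ l, 1 ≤ gm.2) (b : Box)
    (hb : b.room = 1) :
    (l.foldl (Box.step start) b).giant.length = (l.map Prod.snd).prod * b.giant.length := by
  induction l generalizing b with
  | nil => simp
  | cons gm l ih =>
    have hm := hl gm (by simp)
    have hs : b.babies gm.2 = 1 := by simp [Box.babies, hb, hm]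
    have hr : (b.step start gm).room = 1 := by simp [Box.step, hs, hb]
    rw [List.foldl_cons, ih (fun x hx => hl x (by simp [hx])) _ hr,
      show gm = (gm.1, gm.2) from rfl, Box.length_giant_step, Box.giants, hs]
    simp
    ring

/-- The giant steps are multiplied only after the room for baby steps has been used up, up to a
constant factor. -/
lemma Box.length_giant_le (start : ℕ) (l : List (ℕ × ℕ)) (hl : ∀ gm ∈ l, 1 ≤ gm.2) (b : Box)
    (hb : 1 ≤ b.room) :
    (l.foldl (Box.step start) b).giant.length = b.giant.length ∨
      (b.room + 1) * (l.foldl (Box.step start) b).giant.length ≤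
        4 * (l.map Prod.snd).prod * b.giant.length := by
  induction l generalizing b with
  | nil => simp
  | cons gm l ih =>
    have hm := hl gm (by simp)
    have hl' : ∀ x ∈ l, 1 ≤ x.2 := fun x hx => hl x (by simp [hx])
    rw [List.foldl_cons, List.map_cons, List.prod_cons]
    rcases Nat.lt_or_ge b.room gm.2 with h | h
    · right
      have hs : b.babies gm.2 = b.room := min_eq_right h.le
      have hr : (b.step start gm).room = 1 := by
        simp [Box.step, hs, Nat.div_self hb]
      rw [Box.length_giant_of_room start l hl' _ hr, show gm = (gm.1, gm.2) from rfl,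
        Box.length_giant_step, Box.giants, hs]
      have hv : b.room * ((gm.2 + b.room - 1) / b.room) ≤ gm.2 + b.room - 1 :=
        Nat.mul_div_le _ _
      set v := (gm.2 + b.room - 1) / b.room
      have hv' : (b.room + 1) * v ≤ 4 * gm.2 := by
        have h₂ : b.room * v ≤ 2 * gm.2 := by omega
        have h₃ : 1 * v ≤ b.room * v := Nat.mul_le_mul_right v hb
        rw [add_mul]
        omega
      calc (b.room + 1) * ((l.map Prod.snd).prod * (v * b.giant.length))
          = ((b.room + 1) * v) * ((l.map Prod.snd).prod * b.giant.length) := by ring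
        _ ≤ (4 * gm.2) * ((l.map Prod.snd).prod * b.giant.length) := Nat.mul_le_mul_right _ hv'
        _ = _ := by ring
    · have hs : b.babies gm.2 = gm.2 := min_eq_left h
      have hv : b.giants gm.2 = 1 := by
        rw [Box.giants, hs]
        exact Nat.div_eq_of_lt_le (by omega) (by omega)
      have hg : (b.step start gm).giant.length = b.giant.length := by
        rw [show gm = (gm.1, gm.2) from rfl, Box.length_giant_step, hv, one_mul]
      have hr : (b.step start gm).room = b.room / gm.2 := by simp [Box.step, hs]
      have hpos := Box.room_step_pos (b := b) start gm.1 hm hb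
      rcases ih hl' _ hpos with h' | h'
      · left
        rw [h', hg]
      · right
        rw [hg] at h'
        have hlt : b.room + 1 ≤ gm.2 * ((b.step start gm).room + 1) := by
          rw [hr]
          exact Nat.lt_mul_div_succ _ hm
        calc (b.room + 1) * _ ≤ gm.2 * ((b.step start gm).room + 1) * _ :=
              Nat.mul_le_mul_right _ hlt
          _ ≤ gm.2 * (4 * (l.map Prod.snd).prod * b.giant.length) := by
              rw [mul_assoc]; exact Nat.mul_le_mul_left _ h'
          _ = _ := by ring

/-- The length of the script is at most the number of digits times the size of the final tables. -/
lemma Box.length_script_le (start : ℕ) (l : List (ℕ × ℕ)) (hl : ∀ gm ∈ l, 1 ≤ gm.2) (b : Box)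
    (hb : 1 ≤ b.room) (hne : 1 ≤ b.baby.length) :
    let b' := l.foldl (Box.step start) b
    b.baby.length ≤ b'.baby.length ∧ b.giant.length ≤ b'.giant.length ∧
    b'.script.length ≤ b.script.length + l.length * (2 * b'.baby.length + b'.giant.length) := by
  induction l generalizing b with
  | nil => simp
  | cons gm l ih =>
    have hm := hl gm (by simp)
    have hs := Box.babies_pos hm hb
    have hv := Box.giants_pos hm hb
    have e₁ : (b.step start gm).baby.length = b.babies gm.2 * b.baby.length :=
      Box.length_baby_step start gm.1 hm hb
    have e₂ : (b.step start gm).giant.length = b.giants gm.2 * b.giant.length :=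
      Box.length_giant_step start gm.1
    have e₃ : (b.step start gm).script.length = b.script.length +
        (b.babies gm.2 - 1) * b.baby.length + (b.babies gm.2 - 1) +
          b.giants gm.2 * b.giant.length := by
      simp [Box.step, add_assoc]
    have h₁ : b.baby.length ≤ (b.step start gm).baby.length := by
      rw [e₁]; exact Nat.le_mul_of_pos_left _ hs
    have h₂ : b.giant.length ≤ (b.step start gm).giant.length := by
      rw [e₂]; exact Nat.le_mul_of_pos_left _ hv
    have h₃ : (b.step start gm).script.length ≤ b.script.length +
        (2 * (b.step start gm).baby.length + (b.step start gm).giant.length) := by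
      have h₄ : (b.babies gm.2 - 1) * b.baby.length ≤ b.babies gm.2 * b.baby.length :=
        Nat.mul_le_mul_right _ (Nat.sub_le _ _)
      have h₅ : b.babies gm.2 ≤ b.babies gm.2 * b.baby.length :=
        Nat.le_mul_of_pos_right _ hne
      rw [e₁, e₂, e₃]
      omega
    obtain ⟨i₁, i₂, i₃⟩ := ih (fun x hx => hl x (by simp [hx])) _
      (Box.room_step_pos (b := b) start gm.1 hm hb) (hne.trans h₁)
    refine ⟨h₁.trans i₁, h₂.trans i₂, ?_⟩
    rw [List.foldl_cons, List.length_cons, add_mul, one_mul]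
    rw [← show gm = (gm.1, gm.2) from rfl] at i₁ i₂ i₃
    omega

lemma length_script_box_le {start : ℕ} {l : List (ℕ × ℕ)} (hl : ∀ gm ∈ l, 1 ≤ gm.2) :
    (box start (l.map Prod.snd).prod.sqrt l).script.length ≤
      l.length * (10 * (l.map Prod.snd).prod.sqrt) := by
  set M := (l.map Prod.snd).prod with hM
  have hM1 : 1 ≤ M := by
    have : 0 < M := List.prod_pos fun x hx => by
      obtain ⟨gm, h, rfl⟩ := List.mem_map.1 hx
      exact hl gm h
    omega
  have hr : 1 ≤ M.sqrt := by
    rw [Nat.le_sqrt]; omega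
  have h₁ := Box.room_mul_baby_le start l hl ⟨M.sqrt, [0], [0], []⟩ hr
  have h₂ := Box.length_giant_le start l hl ⟨M.sqrt, [0], [0], []⟩ hr
  have h₃ := (Box.length_script_le start l hl ⟨M.sqrt, [0], [0], []⟩ hr (by simp)).2.2
  simp only [List.length_singleton, mul_one, List.length_nil, zero_add, ← hM] at h₁ h₂ h₃
  refine h₃.trans (Nat.mul_le_mul_left _ ?_)
  have h₄ := Nat.lt_succ_sqrt M
  set g := (List.foldl (Box.step start) ⟨M.sqrt, [0], [0], []⟩ l).giant.length
  have h₅ : g ≤ 8 * M.sqrt := by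
    rcases h₂ with h | h
    · omega
    · have : g < 4 * (M.sqrt + 1) := by
        by_contra hcon
        push Not at hcon
        have : M.sqrt.succ * M.sqrt.succ = (M.sqrt + 1) * (M.sqrt + 1) := rfl
        nlinarith
      omega
  omega

/-! ### The subgroup generated by the known generators -/

/-- The subgroup generated by the contents of the registers in the list `l`. -/
def span {K : Type*} [CommGroup K] (κ : ℕ → K) (l : List (ℕ × ℕ)) : Subgroup K :=
  Subgroup.closure {x | ∃ gm ∈ l, κ gm.1 = x}

/-- The exponents in the list `l` are multiples of the orders of the generators modulo the subgroup
generated by the previous ones. -/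
def Chain {K : Type*} [CommGroup K] (κ : ℕ → K) (l : List (ℕ × ℕ)) : Prop :=
  ∀ l₁ gm l₂, l = l₁ ++ gm :: l₂ → κ gm.1 ^ gm.2 ∈ span κ l₁

section Span

variable {K : Type*} [CommGroup K] {κ : ℕ → K} {l : List (ℕ × ℕ)}

@[simp] lemma span_nil : span κ [] = ⊥ := by simp [span]

lemma span_append (gm : ℕ × ℕ) :
    span κ (l ++ [gm]) = span κ l ⊔ Subgroup.zpowers (κ gm.1) := by
  rw [Subgroup.zpowers_eq_closure, span, span, ← Subgroup.closure_union]
  congr 1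
  ext x
  simp only [List.mem_append, List.mem_singleton, or_and_right, exists_or, exists_eq_left,
    Set.mem_ofPred_eq, Set.mem_union, Set.mem_singleton_iff, eq_comm (a := x)]

lemma mem_span {gm : ℕ × ℕ} (h : gm ∈ l) : κ gm.1 ∈ span κ l :=
  Subgroup.subset_closure ⟨gm, h, rfl⟩

lemma span_le {S : Subgroup K} (h : ∀ gm ∈ l, κ gm.1 ∈ S) : span κ l ≤ S := by
  rw [span, Subgroup.closure_le]
  rintro x ⟨gm, hgm, rfl⟩
  exact h gm hgm

lemma chain_nil : Chain κ [] := fun l₁ gm l₂ h => by simp at h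

lemma chain_append {gm : ℕ × ℕ} (hl : Chain κ l) (h : κ gm.1 ^ gm.2 ∈ span κ l) :
    Chain κ (l ++ [gm]) := by
  intro l₁ gm' l₂ he
  rcases List.eq_nil_or_concat l₂ with rfl | ⟨l₃, x, rfl⟩
  · obtain ⟨rfl, h'⟩ := List.append_inj' he rfl
    simp at h'
    rwa [← h']
  · rw [List.concat_eq_append, ← List.cons_append, ← List.append_assoc] at he
    exact hl _ _ l₃ (List.append_inj' he rfl).1

lemma Chain.of_append {gm : ℕ × ℕ} (h : Chain κ (l ++ [gm])) : Chain κ l :=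
  fun l₁ gm' l₂ he => h l₁ gm' (l₂ ++ [gm]) (by simp [he])

lemma Chain.last {gm : ℕ × ℕ} (h : Chain κ (l ++ [gm])) : κ gm.1 ^ gm.2 ∈ span κ l :=
  h l gm [] rfl

lemma covers_box {start room : ℕ} (hr : 1 ≤ room) (hl : ∀ gm ∈ l, 1 ≤ gm.2) (hc : Chain κ l)
    (h : Obeys κ start (box start room l).script) :
    (box start room l).Covers κ (span κ l) := by
  induction l using List.reverseRecOn with
  | nil =>
    intro x hx
    rw [span_nil, Subgroup.mem_bot] at hx
    simp [box, hx, pow_two]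
  | append_singleton l gm ih =>
    rw [box_append] at h ⊢
    have hl' : ∀ x ∈ l, 1 ≤ x.2 := fun x hx => hl x (by simp [hx])
    have h' := h
    simp only [Box.step, obeys_append] at h'
    rw [span_append]
    exact Box.covers_step (hl gm (by simp)) (one_le_room_box hr hl')
      (ih hl' hc.of_append h'.1.1.1) hc.last h

lemma inside_box {start room : ℕ} {S : Subgroup K} (hr : 1 ≤ room) (hl : ∀ gm ∈ l, 1 ≤ gm.2)
    (hS : ∀ gm ∈ l, κ gm.1 ∈ S) (h : Obeys κ start (box start room l).script) :
    (box start room l).Inside κ S := by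
  induction l using List.reverseRecOn with
  | nil => constructor <;> simp [box]
  | append_singleton l gm ih =>
    rw [box_append] at h ⊢
    have hl' : ∀ x ∈ l, 1 ≤ x.2 := fun x hx => hl x (by simp [hx])
    have h' := h
    simp only [Box.step, obeys_append] at h'
    exact Box.inside_step (hl gm (by simp)) (one_le_room_box hr hl')
      (ih hl' (fun x hx => hS x (by simp [hx])) h'.1.1.1) (hS gm (by simp)) h

lemma card_sup_le [Finite K] {H : Subgroup K} {g : K} {m : ℕ} (hm : 1 ≤ m) (hg : g ^ m ∈ H) :
    Nat.card ↥(H ⊔ Subgroup.zpowers g) ≤ m * Nat.card H := by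
  have hmem : ∀ x : Fin m × H, g ^ (x.1 : ℕ) * x.2 ∈ H ⊔ Subgroup.zpowers g := fun x =>
    Subgroup.mul_mem _ (Subgroup.mem_sup_right (Subgroup.npow_mem_zpowers g _))
      (Subgroup.mem_sup_left x.2.2)
  have h := Nat.card_le_card_of_surjective (α := Fin m × H) (β := ↥(H ⊔ Subgroup.zpowers g))
    (fun x => ⟨_, hmem x⟩) fun y => by
      obtain ⟨e, he, z, hz, hy⟩ := exists_pow_mul y.2 hm hg
      exact ⟨(⟨e, he⟩, ⟨z, hz⟩), Subtype.ext hy.symm⟩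
  simpa [Nat.card_prod] using h

lemma le_card_sup [Finite K] {H : Subgroup K} {g : K} {m : ℕ}
    (hg : ∀ j, 1 ≤ j → j < m → g ^ j ∉ H) :
    m * Nat.card H ≤ Nat.card ↥(H ⊔ Subgroup.zpowers g) := by
  have hmem : ∀ x : Fin m × H, g ^ (x.1 : ℕ) * x.2 ∈ H ⊔ Subgroup.zpowers g := fun x =>
    Subgroup.mul_mem _ (Subgroup.mem_sup_right (Subgroup.npow_mem_zpowers g _))
      (Subgroup.mem_sup_left x.2.2)
  have key : ∀ x y : Fin m × H, g ^ (x.1 : ℕ) * x.2 = g ^ (y.1 : ℕ) * y.2 →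
      ¬ (x.1 : ℕ) < y.1 := by
    intro x y h hlt
    refine hg (y.1 - x.1) (by omega) (by omega) ?_
    have h' : (x.2 : K) = g ^ ((y.1 : ℕ) - x.1) * y.2 := by
      have : g ^ (y.1 : ℕ) = g ^ (x.1 : ℕ) * g ^ ((y.1 : ℕ) - x.1) := by
        rw [← pow_add, Nat.add_sub_cancel' hlt.le]
      rw [this, mul_assoc] at h
      exact mul_left_cancel h
    rw [eq_mul_inv_of_mul_eq h'.symm]
    exact H.mul_mem x.2.2 (H.inv_mem y.2.2)
  have h := Nat.card_le_card_of_injective (α := Fin m × H) (β := ↥(H ⊔ Subgroup.zpowers g))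
    (fun x => ⟨_, hmem x⟩) fun x y hxy => by
      have hxy' : g ^ (x.1 : ℕ) * x.2 = g ^ (y.1 : ℕ) * y.2 := congrArg Subtype.val hxy
      have h₁ : x.1 = y.1 :=
        Fin.ext (le_antisymm (not_lt.1 (key y x hxy'.symm)) (not_lt.1 (key x y hxy')))
      rw [h₁] at hxy'
      exact Prod.ext h₁ (Subtype.ext (mul_left_cancel hxy'))
  simpa [Nat.card_prod] using h

lemma card_span_le [Finite K] (hl : ∀ gm ∈ l, 1 ≤ gm.2) (hc : Chain κ l) :
    Nat.card (span κ l) ≤ groupOrder l := by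
  induction l using List.reverseRecOn with
  | nil => simp [groupOrder]
  | append_singleton l gm ih =>
    rw [span_append]
    refine (card_sup_le (hl gm (by simp)) hc.last).trans ?_
    have := ih (fun x hx => hl x (by simp [hx])) hc.of_append
    simp only [groupOrder, List.map_append, List.map_singleton, List.prod_append,
      List.prod_singleton] at this ⊢
    rw [mul_comm]
    exact Nat.mul_le_mul_right _ this

end Span

/-! ### Runs of the algorithm -/

/-- The answers received when the registers are filled with the entries of `z`. -/
def answers {G : Type*} [DecidableEq G] (z : List G) : List ℕ := z.map fun x => z.idxOf x

/-- The content of register `k`, looked up at its first occurrence; `ζ` gives the contents of the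
registers that are first occurrences. -/
def atFirst {G K : Type*} [DecidableEq G] (z : List G) (ζ : ℕ → K) (k : ℕ) : K :=
  ζ ((answers z).getD k 0)

/-- The assignment `ζ` of elements of `K` to first occurrences is consistent with the facts. -/
def Sat {K : Type*} [Mul K] (ζ : ℕ → K) (facts : List (ℕ × ℕ × ℕ)) : Prop :=
  ∀ f ∈ facts, ζ f.1 * ζ f.2.1 = ζ f.2.2

/-- The facts hold for the register contents `z`. -/
def Sound {G : Type*} [CommGroup G] (z : List G) (facts : List (ℕ × ℕ × ℕ)) : Prop :=
  ∀ f ∈ facts, f.1 < z.length ∧ f.2.1 < z.length ∧ f.2.2 < z.length ∧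
    z.getD f.1 1 * z.getD f.2.1 1 = z.getD f.2.2 1

/-- The outputs that are not a basis. -/
def badOutputs (G : Type*) [CommGroup G] : Set (Option (List G)) :=
  {o | ∃ l : List G, o = some l ∧ IsBasis l}ᶜ

/-- From register contents `z` and memory content `m`, the algorithm halts properly within `T` moves
(whatever the answers are), and fails to output a basis with probability at most `ε`. -/
def Ok {G : Type*} [CommGroup G] [Fintype G] [DecidableEq G] (c T : ℕ) (z : List G) (m : Memory)
    (ε : ℝ≥0∞) : Prop :=
  ∀ T' ≥ T, none ∉ ((algorithm c).run T' z m).support ∧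
    ((algorithm c).run T' z m).toOuterMeasure (badOutputs G) ≤ ε

section Answers

variable {G : Type*} [DecidableEq G] {z z' : List G}

@[simp] lemma length_answers : (answers z).length = z.length := by simp [answers]

/-- The answer for a register does not change when further registers are filled. -/
lemma answers_append_singleton (z : List G) (g : G) :
    answers (z ++ [g]) = answers z ++ [z.idxOf g] := by
  rw [answers, List.map_append, List.map_singleton]
  congr 1
  · refine List.map_congr_left fun x hx => ?_
    rw [List.idxOf_append_of_mem hx]
  · by_cases h : g ∈ z
    · rw [List.idxOf_append_of_mem h]
    · rw [List.idxOf_append_of_notMem h, List.idxOf_eq_length h]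
      simp

lemma answers_prefix (h : z <+: z') : answers z <+: answers z' := by
  obtain ⟨t, rfl⟩ := h
  induction t using List.reverseRecOn with
  | nil => simp
  | append_singleton t g ih =>
    rw [← List.append_assoc, answers_append_singleton]
    exact ih.trans (List.prefix_append _ _)

lemma getD_of_prefix {α : Type*} {l l' : List α} (h : l <+: l') {k : ℕ} (hk : k < l.length)
    (d : α) : l'.getD k d = l.getD k d := by
  obtain ⟨t, rfl⟩ := h
  exact List.getD_append _ _ _ _ hk

lemma atFirst_of_prefix {K : Type*} (h : z <+: z') (ζ : ℕ → K) {k : ℕ} (hk : k < z.length) :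
    atFirst z' ζ k = atFirst z ζ k := by
  rw [atFirst, atFirst, getD_of_prefix (answers_prefix h) (by simpa)]

lemma answers_getD {k : ℕ} (hk : k < z.length) : (answers z).getD k 0 = z.idxOf z[k] := by
  rw [List.getD_eq_getElem _ _ (by simpa)]
  simp [answers]

lemma answers_getD_lt {k : ℕ} (hk : k < z.length) : (answers z).getD k 0 < z.length := by
  rw [answers_getD hk]
  exact List.idxOf_lt_length_of_mem (List.getElem_mem hk)

lemma getD_answers [One G] {k : ℕ} (hk : k < z.length) :
    atFirst z (fun i => z.getD i 1) k = z.getD k 1 := by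
  rw [atFirst, answers_getD hk, List.getD_eq_getElem _ _ hk,
    List.getD_eq_getElem _ _ (List.idxOf_lt_length_of_mem (List.getElem_mem hk))]
  simp

lemma answers_eq_iff [One G] {i j : ℕ} (hi : i < z.length) (hj : j < z.length) :
    (answers z).getD i 0 = (answers z).getD j 0 ↔ z.getD i 1 = z.getD j 1 := by
  constructor
  · intro h
    rw [← getD_answers hi, ← getD_answers hj, atFirst, atFirst, h]
  · intro h
    rw [List.getD_eq_getElem _ _ hi, List.getD_eq_getElem _ _ hj] at h
    rw [answers_getD hi, answers_getD hj, h]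

end Answers

lemma Sound.mono {G : Type*} [CommGroup G] {z z' : List G} {facts : List (ℕ × ℕ × ℕ)}
    (h : Sound z facts) (hz : z <+: z') :
    Sound z' facts := by
  intro f hf
  obtain ⟨h₁, h₂, h₃, h₄⟩ := h f hf
  have := hz.length_le
  refine ⟨by omega, by omega, by omega, ?_⟩
  rwa [getD_of_prefix hz h₁, getD_of_prefix hz h₂, getD_of_prefix hz h₃]

lemma Sound.sat {G : Type*} [CommGroup G] {z : List G} {facts : List (ℕ × ℕ × ℕ)}
    (h : Sound z facts) : Sat (fun i => z.getD i 1) facts := fun f hf => (h f hf).2.2.2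

/-- The effect of an uninterrupted sequence of products. -/
structure Extends {G : Type u} [CommGroup G] [DecidableEq G] (z : List G)
    (facts : List (ℕ × ℕ × ℕ)) (sc : List (ℕ × ℕ)) (z' : List G)
    (facts' : List (ℕ × ℕ × ℕ)) : Prop where
  isPrefix : z <+: z'
  length_eq : z'.length = z.length + sc.length
  subset : facts ⊆ facts'
  sound : Sound z facts → Sound z' facts'
  obeys : ∀ (K : Type u) [CommGroup K] (ζ : ℕ → K), Sat ζ facts' →
    Obeys (atFirst z' ζ) z.length sc

/-- The memory after all pending moves. -/
noncomputable def settle (c : ℕ) (ph : Phase) (res : Option (List ℕ)) (ans : List ℕ)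
    (facts : List (ℕ × ℕ × ℕ)) : Memory :=
  if res = none then plan c ⟨ph, none, [], ans, facts⟩ else ⟨ph, res, [], ans, facts⟩

lemma update_mk (c : ℕ) (ph : Phase) (res : Option (List ℕ)) (o : Option (ℕ × ℕ))
    (p : List (Option (ℕ × ℕ))) (ans : List ℕ) (facts : List (ℕ × ℕ × ℕ)) (a : ℕ) :
    update c ⟨ph, res, o :: p, ans, facts⟩ a =
      let facts' := facts ++ (o.map fun ij => (ans.getD ij.1 0, ans.getD ij.2 0, a)).toList
      if p = [] then settle c ph res (ans ++ [a]) facts' else ⟨ph, res, p, ans ++ [a], facts'⟩ := by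
  simp only [update, record, settle, List.tail_cons, List.headI_cons]
  by_cases hp : p = [] <;> cases res <;> simp [hp]

section General

variable {G : Type*} [CommGroup G] [Fintype G] [DecidableEq G] {A : Algorithm} {z : List G}
  {m : A.Mem}

lemma run_sample (T : ℕ) (hm : A.act m = .sample) :
    A.run (T + 1) z m = (PMF.uniformOfFintype G).bind fun g =>
      A.run T (z ++ [g]) (A.upd m (z.idxOf g)) := by
  rw [Algorithm.run]
  simp only [hm]

lemma run_mul (T : ℕ) {i j : ℕ} (hm : A.act m = .mul i j) (hi : i < z.length)
    (hj : j < z.length) :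
    A.run (T + 1) z m =
      A.run T (z ++ [z.getD i 1 * z.getD j 1]) (A.upd m (z.idxOf (z.getD i 1 * z.getD j 1))) := by
  rw [Algorithm.run]
  simp only [hm, List.getElem?_eq_getElem hi, List.getElem?_eq_getElem hj,
    List.getD_eq_getElem _ _ hi, List.getD_eq_getElem _ _ hj]

lemma run_output (T : ℕ) {l : List ℕ} (hm : A.act m = .output l) :
    A.run T z m = PMF.pure (l.mapM fun i => z[i]?) := by
  cases T <;> rw [Algorithm.run] <;> simp only [hm]

end General

section Run

variable {G : Type u} [CommGroup G] [Fintype G] [DecidableEq G] {c T : ℕ} {z : List G}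
  {m : Memory} {ε : ℝ≥0∞}

lemma Ok.mono {T' : ℕ} {ε' : ℝ≥0∞} (h : Ok c T z m ε) (hT : T ≤ T') (hε : ε ≤ ε') :
    Ok c T' z m ε' := fun T'' hT'' =>
  ⟨(h T'' (hT.trans hT'')).1, (h T'' (hT.trans hT'')).2.trans hε⟩

lemma ok_sample (hm : move m = .sample) {ε : G → ℝ≥0∞}
    (h : ∀ g, Ok c T (z ++ [g]) (update c m (z.idxOf g)) (ε g)) :
    Ok c (T + 1) z m (∑ g, (Fintype.card G : ℝ≥0∞)⁻¹ * ε g) := by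
  intro T' hT'
  obtain ⟨T'', rfl⟩ : ∃ T'', T' = T'' + 1 := ⟨T' - 1, by omega⟩
  have hrun : (algorithm c).run (T'' + 1) z m = (PMF.uniformOfFintype G).bind fun g =>
      (algorithm c).run T'' (z ++ [g]) (update c m (z.idxOf g)) := run_sample T'' hm
  rw [hrun]
  constructor
  · rw [PMF.mem_support_bind_iff]
    rintro ⟨g, -, hg⟩
    exact (h g T'' (by omega)).1 hg
  · rw [PMF.toOuterMeasure_bind_apply, tsum_fintype]
    refine Finset.sum_le_sum fun g _ => ?_
    rw [PMF.uniformOfFintype_apply]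
    exact mul_le_mul_right (h g T'' (by omega)).2 _

lemma ok_mul {i j : ℕ} (hm : move m = .mul i j) (hi : i < z.length) (hj : j < z.length)
    (h : Ok c T (z ++ [z.getD i 1 * z.getD j 1])
      (update c m (z.idxOf (z.getD i 1 * z.getD j 1))) ε) : Ok c (T + 1) z m ε := by
  intro T' hT'
  obtain ⟨T'', rfl⟩ : ∃ T'', T' = T'' + 1 := ⟨T' - 1, by omega⟩
  have hrun : (algorithm c).run (T'' + 1) z m = (algorithm c).run T''
      (z ++ [z.getD i 1 * z.getD j 1]) (update c m (z.idxOf (z.getD i 1 * z.getD j 1))) :=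
      run_mul T'' hm hi hj
  rw [hrun]
  exact h T'' (by omega)

lemma ok_output {l : List ℕ} (hm : move m = .output l) (hl : ∀ i ∈ l, i < z.length)
    (h : ¬ IsBasis (l.map fun i => z.getD i 1) → 1 ≤ ε) : Ok c 0 z m ε := by
  intro T' _
  have hmap : (l.mapM fun i => z[i]?) = some (l.map fun i => z.getD i 1) := by
    clear h hm
    induction l with
    | nil => rfl
    | cons i l ih =>
      have hi := hl i (by simp)
      rw [List.mapM_cons, ih fun x hx => hl x (by simp [hx]), List.getElem?_eq_getElem hi]
      simp [List.getElem?_eq_getElem hi]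
  have hrun : (algorithm c).run T' z m = PMF.pure (some (l.map fun i => z.getD i 1)) :=
    (run_output T' hm).trans (congrArg PMF.pure hmap)
  rw [hrun]
  refine ⟨by simp, ?_⟩
  rw [PMF.toOuterMeasure_pure_apply]
  split_ifs with hb
  · refine h fun hbasis => hb ⟨_, rfl, hbasis⟩
  · exact zero_le

/-- A valid script of pending products is carried out. -/
lemma ok_script (ph : Phase) (res : Option (List ℕ)) (facts : List (ℕ × ℕ × ℕ))
    (sc : List (ℕ × ℕ)) (hne : sc ≠ []) (hv : Valid z.length sc) :
    ∃ z' facts', Extends z facts sc z' facts' ∧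
      ∀ {T : ℕ} {ε : ℝ≥0∞}, Ok c T z' (settle c ph res (answers z') facts') ε →
        Ok c (T + sc.length) z ⟨ph, res, sc.map some, answers z, facts⟩ ε := by
  induction sc generalizing z facts with
  | nil => exact absurd rfl hne
  | cons ij sc ih =>
    obtain ⟨hi, hj⟩ := hv 0 (by simp)
    simp only [List.getElem_cons_zero, add_zero] at hi hj
    set x := z.getD ij.1 1 * z.getD ij.2 1 with hx
    set f := ((answers z).getD ij.1 0, (answers z).getD ij.2 0, z.idxOf x) with hf
    have hpre : z <+: z ++ [x] := List.prefix_append _ _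
    have hidx : (answers (z ++ [x])).getD z.length 0 = z.idxOf x := by
      rw [answers_append_singleton, List.getD_append_right _ _ _ _ (by simp)]
      simp
    have hsound : Sound z facts → Sound (z ++ [x]) (facts ++ [f]) := by
      intro h e he
      rcases List.mem_append.1 he with he | he
      · exact h.mono hpre e he
      · rw [List.mem_singleton] at he
        subst he
        have h₁ := answers_getD_lt hi
        have h₂ := answers_getD_lt hj
        have h₃ : z.idxOf x < (z ++ [x]).length := by
          rw [← hidx]; exact answers_getD_lt (by simp)
        have hlen : (z ++ [x]).length = z.length + 1 := by simp
        refine ⟨by rw [hlen]; exact h₁.trans (Nat.lt_succ_self _),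
          by rw [hlen]; exact h₂.trans (Nat.lt_succ_self _), h₃, ?_⟩
        have e₁ := getD_answers hi
        have e₂ := getD_answers hj
        have e₃ := getD_answers (z := z ++ [x]) (k := z.length) (by simp)
        rw [atFirst, hidx] at e₃
        rw [atFirst] at e₁ e₂
        simp only [hf]
        rw [getD_of_prefix hpre h₁, getD_of_prefix hpre h₂, e₁, e₂, e₃]
        simp [hx]
    have hmove : move ⟨ph, res, (ij :: sc).map some, answers z, facts⟩ = .mul ij.1 ij.2 := rfl
    have hupd : update c ⟨ph, res, (ij :: sc).map some, answers z, facts⟩ (z.idxOf x) =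
        if sc = [] then settle c ph res (answers (z ++ [x])) (facts ++ [f])
          else ⟨ph, res, sc.map some, answers (z ++ [x]), facts ++ [f]⟩ := by
      rw [List.map_cons, update_mk, answers_append_singleton]
      simp [hf]
    have hhead : ∀ (K : Type u) [CommGroup K] (ζ : ℕ → K) (z' : List G), z ++ [x] <+: z' →
        ζ f.1 * ζ f.2.1 = ζ f.2.2 →
          atFirst z' ζ z.length = atFirst z' ζ ij.1 * atFirst z' ζ ij.2 := by
      intro K _ ζ z' hz' h
      rw [atFirst_of_prefix hz' ζ (k := z.length) (by simp),
        atFirst_of_prefix (hpre.trans hz') ζ hi, atFirst_of_prefix (hpre.trans hz') ζ hj,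
        atFirst, hidx]
      exact h.symm
    by_cases hsc : sc = []
    · subst hsc
      refine ⟨z ++ [x], facts ++ [f], ⟨hpre, by simp, by simp, hsound, ?_⟩, ?_⟩
      · intro K _ ζ hζ t ht
        have ht0 : t = 0 := by simpa using ht
        subst ht0
        exact hhead K ζ _ List.prefix_rfl (hζ f (by simp))
      · intro T ε h
        refine ok_mul hmove hi hj ?_
        rw [← hx, hupd, if_pos rfl]
        exact h
    · have hv' : Valid (z ++ [x]).length sc := by
        intro t ht
        have := hv (t + 1) (by simpa using ht)
        simpa [add_assoc, add_comm 1] using this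
      obtain ⟨z', facts', hext, hok⟩ := ih (facts ++ [f]) hsc hv'
      refine ⟨z', facts', ⟨hpre.trans hext.isPrefix, ?_, ?_, fun h => hext.sound (hsound h), ?_⟩,
        ?_⟩
      · rw [hext.length_eq]; simp; omega
      · exact fun e he => hext.subset (List.mem_append_left _ he)
      · intro K _ ζ hζ t ht
        cases t with
        | zero =>
          exact hhead K ζ _ hext.isPrefix (hζ f (hext.subset (by simp)))
        | succ t =>
          have := hext.obeys K ζ hζ t (by simpa using ht)
          simpa [add_assoc, add_comm 1] using this
      · intro T ε h
        rw [List.length_cons, ← add_assoc]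
        refine ok_mul hmove hi hj ?_
        rw [← hx, hupd, if_neg hsc]
        exact hok h

end Run

/-! ### Charts -/

lemma mem_allLists {α : Type*} {L l : List α} {n : ℕ} :
    l ∈ allLists L n ↔ l.length = n ∧ ∀ a ∈ l, a ∈ L := by
  induction n generalizing l with
  | zero => simp +contextual [allLists, List.length_eq_zero_iff]
  | succ n ih =>
    have : allLists L (n + 1) =
        (allLists L n).flatMap fun l => L.map fun a => a :: l := rfl
    rw [this, List.mem_flatMap]
    constructor
    · rintro ⟨l', hl', h⟩
      obtain ⟨a, ha, rfl⟩ := List.mem_map.1 h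
      obtain ⟨h₁, h₂⟩ := ih.1 hl'
      simp only [List.length_cons, h₁, List.mem_cons, true_and]
      rintro b (rfl | hb)
      · exact ha
      · exact h₂ b hb
    · rintro ⟨h₁, h₂⟩
      obtain ⟨a, l', rfl⟩ := List.exists_cons_of_length_eq_add_one h₁
      exact ⟨l', ih.2 ⟨by simpa using h₁, fun b hb => h₂ b (by simp [hb])⟩,
        List.mem_map.2 ⟨a, h₂ a (by simp), rfl⟩⟩

lemma mem_characters {n h : ℕ} {f : Character} :
    f ∈ characters n h ↔ f.1 ≤ h ∧ (f.2.1.length = n ∧ ∀ a ∈ f.2.1, a < h) ∧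
      f.2.2.1 < n ∧ f.2.2.2 < n := by
  obtain ⟨d, χ, a, b⟩ := f
  simp only [characters, List.mem_flatMap, List.mem_map, List.mem_range, mem_allLists,
    Prod.mk.injEq]
  constructor
  · rintro ⟨d', hd, χ', hχ, a', ha, b', hb, rfl, rfl, rfl, rfl⟩
    exact ⟨by omega, hχ, ha, hb⟩
  · rintro ⟨hd, hχ, ha, hb⟩
    exact ⟨d, by omega, χ, hχ, a, ha, b, hb, rfl, rfl, rfl, rfl⟩

lemma mem_charts {n h : ℕ} {F : List Character} :
    F ∈ charts n h ↔ F.length < h ∧ ∀ f ∈ F, f ∈ characters n h := by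
  simp only [charts, List.mem_flatMap, List.mem_range, mem_allLists]
  constructor
  · rintro ⟨k, hk, rfl, hF⟩
    exact ⟨hk, hF⟩
  · rintro ⟨hk, hF⟩
    exact ⟨_, hk, rfl, hF⟩

lemma findChart_spec {ans : List ℕ} {facts : List (ℕ × ℕ × ℕ)} {h : ℕ}
    (hex : ∃ F ∈ charts ans.length h, IsChart ans facts h F) :
    findChart ans facts h ∈ charts ans.length h ∧
      IsChart ans facts h (findChart ans facts h) := by
  classical
  have hlt : (charts ans.length h).findIdx (fun F => decide (IsChart ans facts h F)) <
      (charts ans.length h).length := by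
    rw [List.findIdx_lt_length]
    simpa using hex
  have heq : findChart ans facts h = (charts ans.length h)[
      (charts ans.length h).findIdx fun F => decide (IsChart ans facts h F)] := by
    unfold findChart
    rw [← List.getD_eq_getElem _ [] hlt]
  rw [heq]
  exact ⟨List.getElem_mem _, by simpa using List.findIdx_getElem (w := hlt)⟩

/-- What is known about the group after some completed searches: the elements in all registers lie
in the subgroup generated by `gens`, and the relative orders are correct. The statements `chain` and
`inside` hold for every group in which the facts hold; in this sense the facts prove them. -/
structure Known {G : Type u} [CommGroup G] [DecidableEq G] (z : List G)
    (facts : List (ℕ × ℕ × ℕ)) (gens : List (ℕ × ℕ)) : Prop where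
  sound : Sound z facts
  orders : ∀ gm ∈ gens, 2 ≤ gm.2
  regs_lt : ∀ gm ∈ gens, gm.1 < z.length
  chain : ∀ (K : Type u) [CommGroup K] (ζ : ℕ → K), Sat ζ facts → Chain (atFirst z ζ) gens
  inside : ∀ (K : Type u) [CommGroup K] (ζ : ℕ → K), Sat ζ facts →
    ∀ k < z.length, atFirst z ζ k ∈ span (atFirst z ζ) gens
  card_eq : Nat.card (span (fun k => z.getD k 1) gens) = groupOrder gens

section Known

variable {G : Type u} [CommGroup G] [DecidableEq G] {z : List G}
  {facts : List (ℕ × ℕ × ℕ)} {gens : List (ℕ × ℕ)}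

lemma span_congr {K : Type*} [CommGroup K] {κ κ' : ℕ → K} {l : List (ℕ × ℕ)}
    (h : ∀ gm ∈ l, κ gm.1 = κ' gm.1) : span κ l = span κ' l :=
  le_antisymm (span_le fun gm hgm => h gm hgm ▸ mem_span hgm)
    (span_le fun gm hgm => (h gm hgm).symm ▸ mem_span hgm)

lemma Known.span_eq (h : Known z facts gens) :
    span (atFirst z fun i => z.getD i 1) gens = span (fun k => z.getD k 1) gens :=
  span_congr fun gm hgm => getD_answers (h.regs_lt gm hgm)

lemma Known.getD_mem (h : Known z facts gens) (k : ℕ) :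
    z.getD k 1 ∈ span (fun k => z.getD k 1) gens := by
  by_cases hk : k < z.length
  · have := h.inside G _ h.sound.sat k hk
    rwa [h.span_eq, getD_answers hk] at this
  · rw [List.getD_eq_default _ _ (not_lt.1 hk)]
    exact one_mem _

/-- If the known subgroup is the whole group, then a map from first occurrences to `ℤ/d` that respects
the facts comes from a homomorphism. Its graph is the subgroup generated by the pairs that belong to
the generators: this subgroup projects onto `G`, and it has at most as many elements as `G`, because
the facts bound its order. -/
lemma Known.exists_hom [Finite G] (h : Known z facts gens)
    (htop : span (fun k => z.getD k 1) gens = ⊤) {d : ℕ} (hd : 2 ≤ d) (χ : ℕ → ℕ)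
    (hχ : ∀ e ∈ facts, (χ e.1 + χ e.2.1) % d = χ e.2.2 % d) :
    ∃ φ : G →* Multiplicative (ZMod d), ∀ k < z.length,
      φ (z.getD k 1) = Multiplicative.ofAdd (χ ((answers z).getD k 0) : ZMod d) := by
  have : NeZero d := ⟨by omega⟩
  -- The register contents together with the values of `χ` form a model of the facts in `G × ℤ/d`.
  let ζ : ℕ → G × Multiplicative (ZMod d) := fun i =>
    (z.getD i 1, Multiplicative.ofAdd (χ i : ZMod d))
  have hζ : Sat ζ facts := by
    intro e he
    refine Prod.ext (h.sound.sat e he) ?_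
    change Multiplicative.ofAdd ((χ e.1 : ZMod d) + (χ e.2.1 : ZMod d)) = _
    refine congrArg _ ?_
    have := (ZMod.natCast_eq_natCast_iff' _ _ d).2 (hχ e he)
    simpa using this
  have hfst : ∀ k < z.length, (atFirst z ζ k).1 = z.getD k 1 := fun k hk => getD_answers hk
  set D := span (atFirst z ζ) gens with hD
  have hle : Nat.card D ≤ Nat.card G := by
    refine (card_span_le (fun gm hgm => by have := h.orders gm hgm; omega)
      (h.chain _ ζ hζ)).trans ?_
    rw [← h.card_eq, htop, Subgroup.card_top]
  let p : D →* G := (MonoidHom.fst G (Multiplicative (ZMod d))).comp D.subtype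
  have hsurj : Function.Surjective p := by
    rw [← MonoidHom.range_eq_top, eq_top_iff, ← htop]
    refine span_le fun gm hgm => ⟨⟨_, mem_span hgm⟩, ?_⟩
    exact hfst _ (h.regs_lt gm hgm)
  have hbij : Function.Bijective p :=
    (Nat.bijective_iff_surjective_and_card p).2
      ⟨hsurj, le_antisymm hle (Nat.card_le_card_of_surjective _ hsurj)⟩
  let e := MulEquiv.ofBijective p hbij
  refine ⟨((MonoidHom.snd G (Multiplicative (ZMod d))).comp D.subtype).comp e.symm.toMonoidHom,
    fun k hk => ?_⟩
  have he : e.symm (z.getD k 1) = ⟨atFirst z ζ k, h.inside _ ζ hζ k hk⟩ := by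
    rw [MulEquiv.symm_apply_eq]
    exact (hfst k hk).symm
  change (D.subtype (e.symm (z.getD k 1))).2 = _
  rw [he]
  rfl

/-- Elements on which homomorphisms to cyclic groups take the values of the standard basis form a
basis, if the orders of the cyclic groups multiply to the order of the group. -/
lemma isBasis_of_homs {G : Type*} [CommGroup G] [Finite G] {l : List G} {d : Fin l.length → ℕ}
    (hd : ∀ i, 2 ≤ d i)
    (hcard : ∏ i, d i = Nat.card G) (φ : ∀ i, G →* Multiplicative (ZMod (d i)))
    (hφ : ∀ i j, (φ j (l.get i)).toAdd = if i = j then 1 else 0) : IsBasis l := by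
  have : ∀ i, NeZero (d i) := fun i => ⟨by have := hd i; omega⟩
  have : ∀ i, Fact (1 < d i) := fun i => ⟨hd i⟩
  have hpow : ∀ (k : Fin l.length → ℤ) j,
      (φ j (∏ i, l.get i ^ k i)).toAdd = (k j : ZMod (d j)) := by
    intro k j
    rw [map_prod, toAdd_prod, Finset.sum_eq_single j]
    · rw [map_zpow, toAdd_zpow, hφ, if_pos rfl]
      simp
    · intro i _ hij
      rw [map_zpow, toAdd_zpow, hφ, if_neg hij, smul_zero]
    · simp
  let Φ : G → ∀ i, ZMod (d i) := fun x i => (φ i x).toAdd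
  have hsurj : Function.Surjective Φ := by
    intro y
    refine ⟨∏ i, l.get i ^ ((y i).val : ℤ), funext fun j => (hpow _ j).trans ?_⟩
    simp
  have hinj : Function.Injective Φ := by
    refine ((Nat.bijective_iff_surjective_and_card Φ).2 ⟨hsurj, ?_⟩).1
    rw [Nat.card_pi, ← hcard]
    simp
  refine ⟨fun a ha h1 => ?_, fun f f' hff => ?_, fun x => ?_⟩
  · obtain ⟨i, rfl⟩ := List.mem_iff_get.1 ha
    have := hφ i i
    rw [h1, map_one, if_pos rfl] at this
    exact zero_ne_one this
  · choose k hk using fun i => Subgroup.mem_zpowers_iff.1 (f i).2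
    choose k' hk' using fun i => Subgroup.mem_zpowers_iff.1 (f' i).2
    have h₁ : (∏ i, (f i : G)) = ∏ i, l.get i ^ k i := Finset.prod_congr rfl fun i _ => (hk i).symm
    have h₂ : (∏ i, (f' i : G)) = ∏ i, l.get i ^ k' i :=
      Finset.prod_congr rfl fun i _ => (hk' i).symm
    simp only at hff
    rw [h₁, h₂] at hff
    funext i
    apply Subtype.ext
    rw [← hk i, ← hk' i]
    refine hinj (funext fun j => ?_)
    have := hpow k j
    rw [hff, hpow k' j] at this
    simp only [Φ, map_zpow, toAdd_zpow, hφ]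
    split_ifs with hij
    · subst hij
      simpa using this.symm
    · simp
  · refine ⟨fun i => ⟨l.get i ^ ((Φ x i).val : ℤ), Subgroup.zpow_mem_zpowers _ _⟩, hinj ?_⟩
    funext j
    simp only [Φ]
    rw [hpow]
    simp

/-- A chart yields a basis. -/
lemma Known.isBasis [Finite G] (h : Known z facts gens)
    (htop : span (fun k => z.getD k 1) gens = ⊤) {F : List Character}
    (hF : IsChart (answers z) facts (groupOrder gens) F)
    (hlt : ∀ f ∈ F, f.2.2.1 < z.length ∧ f.2.2.2 < z.length) :
    IsBasis (F.map fun f => z.getD f.2.2.1 1 * z.getD f.2.2.2 1) := by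
  obtain ⟨h₁, h₂, h₃, h₄⟩ := hF
  set l := F.map fun f => z.getD f.2.2.1 1 * z.getD f.2.2.2 1 with hl
  have hlen : l.length = F.length := by simp [hl]
  have hmem : ∀ i : Fin l.length, F.getD i default ∈ F := fun i => by
    rw [List.getD_eq_getElem _ _ (by omega)]
    exact List.getElem_mem _
  have hget : ∀ i : Fin l.length, l.get i =
      z.getD (F.getD i default).2.2.1 1 * z.getD (F.getD i default).2.2.2 1 := fun i => by
    rw [show F.getD i default = F[(i : ℕ)] from List.getD_eq_getElem _ _ (by omega)]
    simp [hl]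
  choose φ hφ using fun i : Fin l.length => h.exists_hom htop (h₁ _ (hmem i))
    (fun k => (F.getD i default).2.1.getD k 0) (h₂ _ (hmem i))
  refine isBasis_of_homs (d := fun i => (F.getD i default).1) (fun i => h₁ _ (hmem i)) ?_ φ ?_
  · rw [← Subgroup.card_top (G := G), ← htop, h.card_eq, ← h₃, ← List.prod_ofFn]
    congr 1
    refine List.ext_getElem (by simp [hlen]) fun i hi hi' => ?_
    simp only [List.getElem_ofFn, List.getElem_map]
    rw [List.getD_eq_getElem _ _ (by simpa using hi')]
  · intro i j
    have : Fact (1 < (F.getD j default).1) := ⟨h₁ _ (hmem j)⟩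
    have hij := h₄ i (by omega) j (by omega)
    rw [hget, map_mul, toAdd_mul, hφ j _ (hlt _ (hmem i)).1, hφ j _ (hlt _ (hmem i)).2]
    simp only [toAdd_ofAdd]
    rw [← Nat.cast_add, ← ZMod.natCast_mod, hij]
    simp only [← Fin.ext_iff]
    split_ifs <;> simp

/-- A chart exists, by the structure theorem for finite abelian groups, provided that every element
of the known subgroup is a product of two registers. -/
lemma Known.exists_chart [Finite G] (h : Known z facts gens)
    (hcov : ∀ x ∈ span (fun k => z.getD k 1) gens, ∃ a < z.length, ∃ b < z.length,
      z.getD a 1 * z.getD b 1 = x) :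
    ∃ F ∈ charts (answers z).length (groupOrder gens),
      IsChart (answers z) facts (groupOrder gens) F := by
  classical
  set H := span (fun k => z.getD k 1) gens with hH
  obtain ⟨ι, _, n, hn, ⟨e⟩⟩ := CommGroup.equiv_prod_multiplicative_zmod_of_finite H
  have : ∀ i, NeZero (n i) := fun i => ⟨by have := hn i; omega⟩
  have : ∀ i, Fact (1 < n i) := fun i => ⟨hn i⟩
  have hprod : ∏ i, n i = groupOrder gens := by
    rw [← h.card_eq, Nat.card_congr e.toEquiv, Nat.card_pi]
    refine Finset.prod_congr rfl fun i _ => ?_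
    rw [Nat.card_congr Multiplicative.toAdd, Nat.card_zmod]
  have hnle : ∀ i, n i ≤ groupOrder gens := fun i => by
    rw [← hprod]
    exact Nat.le_of_dvd (Finset.prod_pos fun j _ => (hn j).trans' zero_lt_one)
      (Finset.dvd_prod_of_mem _ (Finset.mem_univ i))
  let w : ℕ → H := fun k => ⟨z.getD k 1, h.getD_mem k⟩
  let ψ : ∀ i, ℕ → ℕ := fun i k => (e (w k) i).toAdd.val
  have hψ : ∀ i a b x, z.getD a 1 * z.getD b 1 = x → ∀ hx : x ∈ H,
      (ψ i a + ψ i b) % n i = (e ⟨x, hx⟩ i).toAdd.val := by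
    rintro i a b x rfl hx
    have : (⟨_, hx⟩ : H) = w a * w b := rfl
    rw [this, map_mul, Pi.mul_apply, toAdd_mul, ZMod.val_add]
  let y : ι → H := fun i => e.symm (Pi.mulSingle i (Multiplicative.ofAdd 1))
  choose a ha b hb hab using fun i => hcov (y i) (y i).2
  let E := Fintype.equivFin ι
  let f : Fin (Fintype.card ι) → Character := fun t =>
    (n (E.symm t), (List.range z.length).map (ψ (E.symm t)), a (E.symm t), b (E.symm t))
  have hχ : ∀ t k, k < z.length → (f t).2.1.getD k 0 = ψ (E.symm t) k := fun t k hk => by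
    rw [List.getD_eq_getElem _ _ (by simpa [f] using hk)]
    simp [f]
  have hans : ∀ i k, k < z.length → ψ i ((answers z).getD k 0) = ψ i k := by
    intro i k hk
    have hw : w ((answers z).getD k 0) = w k := Subtype.ext (getD_answers hk)
    simp only [ψ, hw]
  refine ⟨List.ofFn f, mem_charts.2 ⟨?_, ?_⟩, ?_, ?_, ?_, ?_⟩
  · rw [List.length_ofFn]
    calc Fintype.card ι < 2 ^ Fintype.card ι := Nat.lt_two_pow_self
      _ = ∏ _i : ι, 2 := by simp
      _ ≤ ∏ i, n i := Finset.prod_le_prod' fun i _ => hn i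
      _ = _ := hprod
  · intro g hg
    obtain ⟨t, rfl⟩ := List.mem_ofFn.1 hg
    refine mem_characters.2 ⟨hnle _, ⟨by simp [f], ?_⟩, by simpa [f] using ha _,
      by simpa [f] using hb _⟩
    intro x hx
    obtain ⟨k, -, rfl⟩ := List.mem_map.1 hx
    exact (ZMod.val_lt _).trans_le (hnle _)
  · intro g hg
    obtain ⟨t, rfl⟩ := List.mem_ofFn.1 hg
    exact hn _
  · intro g hg ex hex
    obtain ⟨t, rfl⟩ := List.mem_ofFn.1 hg
    obtain ⟨h₁, h₂, h₃, h₄⟩ := h.sound ex hex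
    rw [hχ t _ h₁, hχ t _ h₂, hχ t _ h₃]
    change (ψ (E.symm t) _ + ψ (E.symm t) _) % n (E.symm t) = ψ (E.symm t) _ % n (E.symm t)
    rw [hψ _ _ _ _ h₄ (h.getD_mem _)]
    exact (Nat.mod_eq_of_lt (ZMod.val_lt _)).symm
  · rw [List.map_ofFn, List.prod_ofFn, ← hprod]
    exact Fintype.prod_equiv E.symm _ _ fun t => rfl
  · intro i hi j hj
    rw [List.length_ofFn] at hi hj
    have hget : ∀ k (hk : k < Fintype.card ι), (List.ofFn f).getD k default = f ⟨k, hk⟩ :=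
      fun k hk => by
        rw [List.getD_eq_getElem _ _ (by rwa [List.length_ofFn]), List.getElem_ofFn]
    rw [hget i hi, hget j hj]
    set s : Fin (Fintype.card ι) := ⟨i, hi⟩
    set t : Fin (Fintype.card ι) := ⟨j, hj⟩
    have hsa := ha (E.symm s)
    have hsb := hb (E.symm s)
    rw [hχ t _ (answers_getD_lt hsa), hχ t _ (answers_getD_lt hsb)]
    change (ψ (E.symm t) ((answers z).getD (a (E.symm s)) 0) +
      ψ (E.symm t) ((answers z).getD (b (E.symm s)) 0)) % n (E.symm t) = _
    rw [hans _ _ hsa, hans _ _ hsb, hψ _ _ _ _ (hab _) (y (E.symm s)).2]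
    simp only [y, Subtype.coe_eta, MulEquiv.apply_symm_apply]
    by_cases hst : i = j
    · have : s = t := Fin.ext hst
      rw [this, if_pos hst, Pi.mulSingle_eq_same, toAdd_ofAdd, ZMod.val_one]
    · have : E.symm t ≠ E.symm s := fun heq => hst (congrArg Fin.val (E.symm.injective heq)).symm
      rw [if_neg hst, Pi.mulSingle_eq_of_ne this, toAdd_one, ZMod.val_zero]

end Known

/-! ### One search -/

lemma Phase.relOrder_pos (ph : Phase) (ans : List ℕ) : 1 ≤ ph.relOrder ans :=
  Nat.le_add_left _ _

lemma Phase.collision_relOrder {ph : Phase} {ans : List ℕ} (h : ph.relOrder ans ≤ ph.bound) :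
    ph.Collision ans (ph.relOrder ans) := by
  classical
  unfold Phase.relOrder at h ⊢
  set p : ℕ → Bool := fun i => decide (ph.Collision ans (i + 1)) with hp
  have hlt : (List.range ph.bound).findIdx p < (List.range ph.bound).length := by
    rw [List.length_range]; omega
  have := List.findIdx_getElem (w := hlt)
  rw [List.getElem_range, hp] at this
  exact of_decide_eq_true this

lemma Phase.not_collision {ph : Phase} {ans : List ℕ} {j : ℕ} (h₁ : 1 ≤ j)
    (h₂ : j < ph.relOrder ans) : ¬ ph.Collision ans j := by
  classical
  unfold Phase.relOrder at h₂
  set p : ℕ → Bool := fun i => decide (ph.Collision ans (i + 1)) with hp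
  have hlt : j - 1 < (List.range ph.bound).findIdx p := by omega
  have := List.not_of_lt_findIdx hlt
  rw [List.getElem_range, hp] at this
  have := of_decide_eq_false this
  rwa [Nat.sub_add_cancel h₁] at this

/-- What is known during the search for the relative order of the element in register `cur`. -/
structure Searching {G : Type u} [CommGroup G] [DecidableEq G] (z : List G)
    (facts : List (ℕ × ℕ × ℕ)) (gens : List (ℕ × ℕ)) (cur : ℕ) : Prop where
  sound : Sound z facts
  orders : ∀ gm ∈ gens, 2 ≤ gm.2
  regs_lt : ∀ gm ∈ gens, gm.1 < z.length
  cur_lt : cur < z.length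
  chain : ∀ (K : Type u) [CommGroup K] (ζ : ℕ → K), Sat ζ facts → Chain (atFirst z ζ) gens
  inside : ∀ (K : Type u) [CommGroup K] (ζ : ℕ → K), Sat ζ facts →
    ∀ k < z.length, atFirst z ζ k ∈
      span (atFirst z ζ) gens ⊔ Subgroup.zpowers (atFirst z ζ cur)
  card_eq : Nat.card (span (fun k => z.getD k 1) gens) = groupOrder gens

lemma Sat.mono {K : Type*} [Mul K] {ζ : ℕ → K} {facts facts' : List (ℕ × ℕ × ℕ)}
    (h : Sat ζ facts') (hs : facts ⊆ facts') : Sat ζ facts := fun f hf => h f (hs hf)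

lemma Chain.congr {K : Type*} [CommGroup K] {κ κ' : ℕ → K} {l : List (ℕ × ℕ)} (h : Chain κ l)
    (hl : ∀ gm ∈ l, κ gm.1 = κ' gm.1) : Chain κ' l := by
  intro l₁ gm l₂ he
  rw [← hl gm (by simp [he]), ← span_congr (κ := κ) fun x hx => hl x (by simp [he, hx])]
  exact h l₁ gm l₂ he

lemma span_of_prefix {G K : Type*} [DecidableEq G] [CommGroup K] {z z' : List G}
    {gens : List (ℕ × ℕ)} (hz : z <+: z') (ζ : ℕ → K)
    (h : ∀ gm ∈ gens, gm.1 < z.length) :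
    span (atFirst z' ζ) gens = span (atFirst z ζ) gens :=
  span_congr fun gm hgm => atFirst_of_prefix hz ζ (h gm hgm)

section Search

variable {G : Type u} [CommGroup G] [DecidableEq G] {z z' : List G}
  {facts facts' : List (ℕ × ℕ × ℕ)} {gens : List (ℕ × ℕ)} {cur : ℕ}

lemma Known.sample (h : Known z facts gens) (g : G) :
    Searching (z ++ [g]) facts gens z.length := by
  have hz : z <+: z ++ [g] := List.prefix_append _ _
  refine ⟨h.sound.mono hz, h.orders, fun gm hgm => ?_, by simp, fun K _ ζ hζ => ?_,
    fun K _ ζ hζ k hk => ?_, ?_⟩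
  · have := h.regs_lt gm hgm
    simp; omega
  · exact (h.chain K ζ hζ).congr fun gm hgm => (atFirst_of_prefix hz ζ (h.regs_lt gm hgm)).symm
  · rcases Nat.lt_or_ge k z.length with hk' | hk'
    · rw [span_of_prefix hz ζ h.regs_lt, atFirst_of_prefix hz ζ hk']
      exact Subgroup.mem_sup_left (h.inside K ζ hζ k hk')
    · have : k = z.length := by simp at hk; omega
      subst this
      exact Subgroup.mem_sup_right (Subgroup.mem_zpowers _)
  · rw [← h.card_eq]
    refine congrArg (fun S : Subgroup G => Nat.card S) ?_
    exact span_congr (κ := fun k => (z ++ [g]).getD k 1) (κ' := fun k => z.getD k 1) fun gm hgm =>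
      getD_of_prefix hz (h.regs_lt gm hgm) 1

lemma Searching.span_eq (h : Searching z facts gens cur) :
    span (atFirst z fun i => z.getD i 1) gens = span (fun k => z.getD k 1) gens :=
  span_congr fun gm hgm => getD_answers (h.regs_lt gm hgm)

/-- The script of a search adds only products of elements already available. -/
lemma Searching.extends (h : Searching z facts gens cur) {sc : List (ℕ × ℕ)}
    (hv : Valid z.length sc) (he : Extends z facts sc z' facts') :
    Searching z' facts' gens cur := by
  have hlen := he.isPrefix.length_le
  refine ⟨he.sound h.sound, h.orders, fun gm hgm => (h.regs_lt gm hgm).trans_le hlen,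
    h.cur_lt.trans_le hlen, fun K _ ζ hζ => ?_, fun K _ ζ hζ k hk => ?_, ?_⟩
  · exact (h.chain K ζ (hζ.mono he.subset)).congr fun gm hgm =>
      (atFirst_of_prefix he.isPrefix ζ (h.regs_lt gm hgm)).symm
  · rw [span_of_prefix he.isPrefix ζ h.regs_lt, atFirst_of_prefix he.isPrefix ζ h.cur_lt]
    induction k using Nat.strong_induction_on with
    | _ k ih =>
      rcases Nat.lt_or_ge k z.length with hk' | hk'
      · rw [atFirst_of_prefix he.isPrefix ζ hk']
        exact h.inside K ζ (hζ.mono he.subset) k hk'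
      · obtain ⟨t, rfl⟩ := Nat.exists_eq_add_of_le hk'
        have ht : t < sc.length := by
          rw [he.length_eq] at hk; omega
        obtain ⟨h₁, h₂⟩ := hv t ht
        rw [he.obeys K ζ hζ t ht]
        exact mul_mem (ih _ h₁ (by omega)) (ih _ h₂ (by omega))
  · rw [← h.card_eq]
    refine congrArg (fun S : Subgroup G => Nat.card S) ?_
    exact span_congr (κ := fun k => z'.getD k 1) (κ' := fun k => z.getD k 1) fun gm hgm =>
      getD_of_prefix he.isPrefix (h.regs_lt gm hgm) 1

lemma upper_eq (ph : Phase) :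
    ph.upper = box ph.start (groupOrder ph.gens * ph.bound).sqrt (ph.gens ++ [(ph.cur, ph.bound)]) :=
  (box_append _ _ _ _).symm

lemma groupOrder_append (l : List (ℕ × ℕ)) (gm : ℕ × ℕ) :
    groupOrder (l ++ [gm]) = groupOrder l * gm.2 := by simp [groupOrder]

lemma two_pow_length_le {l : List (ℕ × ℕ)} (h : ∀ gm ∈ l, 2 ≤ gm.2) :
    2 ^ l.length ≤ groupOrder l := by
  induction l with
  | nil => simp [groupOrder]
  | cons gm l ih =>
    have h₁ := h gm (by simp)
    have h₂ := ih fun x hx => h x (by simp [hx])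
    simp only [groupOrder, List.length_cons, List.map_cons, List.prod_cons] at h₂ ⊢
    rw [pow_succ, mul_comm]
    exact Nat.mul_le_mul h₁ h₂

section Phase

variable {R need : ℕ}

lemma one_le_room (h : ∀ gm ∈ gens, 2 ≤ gm.2) (hR : 1 ≤ R) :
    1 ≤ (groupOrder gens * R).sqrt := by
  rw [Nat.le_sqrt]
  have h₁ := two_pow_length_le h
  have h₂ : 1 ≤ 2 ^ gens.length := Nat.one_le_two_pow
  have := Nat.mul_le_mul (h₂.trans h₁) hR
  omega

lemma Searching.bounded (h : Searching z facts gens cur) (hR : 1 ≤ R) :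
    (Phase.mk gens cur R need z.length).lower.Bounded z.length ∧
      (Phase.mk gens cur R need z.length).upper.Bounded z.length := by
  have hz : 0 < z.length := by have := h.cur_lt; omega
  have hl : ∀ gm ∈ gens, 1 ≤ gm.2 := fun gm hgm => by have := h.orders gm hgm; omega
  have h₁ : (Phase.mk gens cur R need z.length).lower.Bounded z.length :=
    bounded_box (one_le_room h.orders hR) hl hz h.regs_lt
  exact ⟨h₁, Box.bounded_step hR (one_le_room_box (one_le_room h.orders hR) hl) h₁ h.cur_lt⟩

lemma length_script_upper_le (h : ∀ gm ∈ gens, 2 ≤ gm.2) (hR : 1 ≤ R) (start : ℕ) :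
    (Phase.mk gens cur R need start).upper.script.length ≤
      (gens.length + 1) * (10 * (groupOrder gens * R).sqrt) := by
  have := length_script_box_le (start := start) (l := gens ++ [(cur, R)]) (by
    intro gm hgm
    rcases List.mem_append.1 hgm with hgm | hgm
    · have := h gm hgm; omega
    · rw [List.mem_singleton] at hgm
      subst hgm
      exact hR)
  rw [upper_eq]
  simpa [groupOrder] using this

lemma script_upper_ne_nil (h : ∀ gm ∈ gens, 2 ≤ gm.2) (hR : 1 ≤ R) (start : ℕ) :
    (Phase.mk gens cur R need start).upper.script ≠ [] := by
  have hl : ∀ gm ∈ gens, 1 ≤ gm.2 := fun gm hgm => by have := h gm hgm; omega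
  have hr := one_le_room h hR
  have hv := Box.giants_pos (b := (Phase.mk gens cur R need start).lower) hR
    (one_le_room_box hr hl)
  have hg : 1 ≤ (Phase.mk gens cur R need start).lower.giant.length :=
    (Box.length_script_le start gens hl ⟨(groupOrder gens * R).sqrt, [0], [0], []⟩ hr
      (by simp)).2.1
  intro h0
  have := congrArg List.length h0
  simp only [Phase.upper, Box.step, List.length_append, length_powScript, List.length_nil,
    Nat.add_eq_zero_iff, Nat.mul_eq_zero] at this
  omega

lemma lower_obeys (he : Extends z facts (Phase.mk gens cur R need z.length).upper.script z' facts')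
    {K : Type u} [CommGroup K] {ζ : ℕ → K} (hζ : Sat ζ facts') :
    Obeys (atFirst z' ζ) z.length (Phase.mk gens cur R need z.length).lower.script := by
  have := he.obeys K ζ hζ
  simp only [Phase.upper, Box.step, obeys_append] at this
  exact this.1.1.1

/-- A collision proves a relation. -/
lemma Searching.pow_mem {j : ℕ} (h : Searching z facts gens cur) (hR : 1 ≤ R)
    (he : Extends z facts (Phase.mk gens cur R need z.length).upper.script z' facts')
    (hj : (Phase.mk gens cur R need z.length).Collision (answers z') j)
    {K : Type u} [CommGroup K] {ζ : ℕ → K} (hζ : Sat ζ facts') :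
    atFirst z' ζ cur ^ j ∈ span (atFirst z' ζ) gens := by
  obtain ⟨p, hp, q, hq, h₁, h₂⟩ := hj
  have hl : ∀ gm ∈ gens, 1 ≤ gm.2 := fun gm hgm => by have := h.orders gm hgm; omega
  have hr := one_le_room h.orders hR
  exact Box.pow_mem_of_collision hR (one_le_room_box hr hl)
    (inside_box hr hl (fun gm hgm => mem_span hgm) (lower_obeys he hζ))
    (he.obeys K ζ hζ) hp hq (congrArg ζ h₁) h₂

lemma Searching.lower_covers (h : Searching z facts gens cur) (hR : 1 ≤ R)
    (he : Extends z facts (Phase.mk gens cur R need z.length).upper.script z' facts') :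
    (Phase.mk gens cur R need z.length).lower.Covers (atFirst z' fun i => z'.getD i 1)
      (span (fun k => z'.getD k 1) gens) := by
  have hl : ∀ gm ∈ gens, 1 ≤ gm.2 := fun gm hgm => by have := h.orders gm hgm; omega
  have h' := h.extends (h.bounded hR).2.1 he
  rw [← h'.span_eq]
  exact covers_box (one_le_room h.orders hR) hl (h'.chain G _ h'.sound.sat)
    (lower_obeys he h'.sound.sat)

/-- A relation within the bound leads to a collision. -/
lemma Searching.collision {j : ℕ} (h : Searching z facts gens cur) (hR : 1 ≤ R)
    (he : Extends z facts (Phase.mk gens cur R need z.length).upper.script z' facts')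
    (hj : 1 ≤ j) (hjR : j ≤ R)
    (hg : z'.getD cur 1 ^ j ∈ span (fun k => z'.getD k 1) gens) :
    (Phase.mk gens cur R need z.length).Collision (answers z') j := by
  have hl : ∀ gm ∈ gens, 1 ≤ gm.2 := fun gm hgm => by have := h.orders gm hgm; omega
  have h' := h.extends (h.bounded hR).2.1 he
  have hb := (h.bounded (need := need) hR).2
  rw [← getD_answers h'.cur_lt] at hg
  obtain ⟨p, hp, q, hq, h₁, h₂⟩ := Box.exists_collision hR
    (one_le_room_box (one_le_room h.orders hR) hl) (h.lower_covers hR he)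
    (he.obeys G _ h'.sound.sat) hj hjR hg
  have hlt : ∀ {L : List ℕ} {p : ℕ}, (∀ i ∈ L, i < z.length +
      (Phase.mk gens cur R need z.length).upper.script.length) → p < L.length →
      L.getD p 0 < z'.length := fun {L p} hL hp => by
    rw [he.length_eq, List.getD_eq_getElem _ _ hp]
    exact hL _ (List.getElem_mem hp)
  have hp' := hlt hb.2.1 hp
  have hq' := hlt hb.2.2 hq
  refine ⟨p, hp, q, hq, ?_, h₂⟩
  rw [answers_eq_iff hp' hq', ← getD_answers hp', ← getD_answers hq']
  exact h₁

/-- If the element is found to lie in the known subgroup, then so do all registers. -/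
lemma Searching.known_of_one (h : Searching z facts gens cur) (hR : 1 ≤ R)
    (he : Extends z facts (Phase.mk gens cur R need z.length).upper.script z' facts')
    (hj : (Phase.mk gens cur R need z.length).Collision (answers z') 1) :
    Known z' facts' gens := by
  have h' := h.extends (h.bounded hR).2.1 he
  refine ⟨h'.sound, h'.orders, h'.regs_lt, h'.chain, fun K _ ζ hζ k hk => ?_, h'.card_eq⟩
  have h₁ := h.pow_mem hR he hj hζ
  rw [pow_one] at h₁
  have := h'.inside K ζ hζ k hk
  rwa [sup_eq_left.2 ((Subgroup.zpowers_le).2 h₁)] at this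

/-- The known subgroup is covered by products of two registers. -/
lemma Searching.exists_mul_eq (h : Searching z facts gens cur) (hR : 1 ≤ R)
    (he : Extends z facts (Phase.mk gens cur R need z.length).upper.script z' facts')
    (hk : Known z' facts' gens) :
    ∀ x ∈ span (fun k => z'.getD k 1) gens, ∃ a < z'.length, ∃ b < z'.length,
      z'.getD a 1 * z'.getD b 1 = x := by
  intro x hx
  have hz : 0 < z'.length := by have := (h.extends (h.bounded hR).2.1 he).cur_lt; omega
  have hb := (h.bounded (need := need) hR).1
  have hlen : z.length + (Phase.mk gens cur R need z.length).lower.script.length ≤ z'.length := by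
    rw [he.length_eq]
    simp only [Phase.upper, Box.step, List.length_append]
    omega
  have h0 := hk.getD_mem 0
  obtain ⟨i, hi, j, hj, hij⟩ := (h.lower_covers hR he (x * (z'.getD 0 1 ^ 2)⁻¹)
    (mul_mem hx (inv_mem (Subgroup.pow_mem _ h0 2)))).2
  have hi' := (hb.2.1 i hi).trans_le hlen
  have hj' := (hb.2.2 j hj).trans_le hlen
  rw [getD_answers hi', getD_answers hj', getD_answers hz, inv_mul_cancel_right] at hij
  exact ⟨i, hi', j, hj', hij⟩

/-- A new generator, once its relative order `r` has been found. -/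
lemma Searching.known_append [Finite G] (h : Searching z facts gens cur) (hR : 1 ≤ R)
    (he : Extends z facts (Phase.mk gens cur R need z.length).upper.script z' facts')
    {r : ℕ} (hr : 2 ≤ r)
    (hj : (Phase.mk gens cur R need z.length).Collision (answers z') r)
    (hmin : ∀ j, 1 ≤ j → j < r → z'.getD cur 1 ^ j ∉ span (fun k => z'.getD k 1) gens) :
    Known z' facts' (gens ++ [(cur, r)]) := by
  have h' := h.extends (h.bounded hR).2.1 he
  refine ⟨h'.sound, ?_, ?_, fun K _ ζ hζ => chain_append (h'.chain K ζ hζ)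
    (h.pow_mem hR he hj hζ), fun K _ ζ hζ k hk => ?_, ?_⟩
  · intro gm hgm
    rcases List.mem_append.1 hgm with hgm | hgm
    · exact h.orders gm hgm
    · rw [List.mem_singleton] at hgm
      rwa [hgm]
  · intro gm hgm
    rcases List.mem_append.1 hgm with hgm | hgm
    · exact h'.regs_lt gm hgm
    · rw [List.mem_singleton] at hgm
      rw [hgm]
      exact h'.cur_lt
  · rw [span_append]
    exact h'.inside K ζ hζ k hk
  · rw [span_append, groupOrder_append, ← h'.card_eq, mul_comm]
    refine le_antisymm (card_sup_le (by omega) ?_) (le_card_sup hmin)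
    have := h.pow_mem hR he hj h'.sound.sat
    rwa [h'.span_eq, getD_answers h'.cur_lt] at this

end Phase

end Search

section Cost

variable {G : Type u} [CommGroup G] [Fintype G] [DecidableEq G] {z : List G}
  {facts : List (ℕ × ℕ × ℕ)} {gens : List (ℕ × ℕ)}

/-- Bound for the number of products that compute the tables of one search. -/
def tableCost (n : ℕ) : ℕ := (Nat.log 2 n + 1) * (10 * (2 * n).sqrt)

lemma groupOrder_le {G : Type*} [CommGroup G] [Fintype G] {z : List G} {gens : List (ℕ × ℕ)}
    (h : Nat.card (span (fun k => z.getD k 1) gens) = groupOrder gens) :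
    groupOrder gens ≤ Fintype.card G := by
  rw [← h, ← Nat.card_eq_fintype_card]
  exact Subgroup.card_le_card_group _

/-- The tables stay small because the bound `R` is at most about twice the relative order sought. -/
lemma Searching.script_le_tableCost {cur need R : ℕ} (h : Searching z facts gens cur) (hR : 1 ≤ R)
    {g : G} {H : Subgroup G} (hH : span (fun k => z.getD k 1) gens = H)
    (hq : ∀ j, 1 ≤ j → 2 * j ≤ R → g ^ j ∉ H) (start : ℕ) :
    (Phase.mk gens cur R need start).upper.script.length ≤ tableCost (Fintype.card G) := by
  -- `H ⊔ ⟨g⟩` has at least `R / 2 + 1` cosets of `H`.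
  have hcard : groupOrder gens * R ≤ 2 * Fintype.card G := by
    have h₁ := le_card_sup (H := H) (g := g) (m := R / 2 + 1) fun j hj hjm =>
      hq j hj (by omega)
    have h₂ := Subgroup.card_le_card_group (H ⊔ Subgroup.zpowers g)
    rw [← hH, h.card_eq, hH] at h₁
    rw [Nat.card_eq_fintype_card (α := G)] at h₂
    have h₃ : R ≤ 2 * (R / 2 + 1) := by omega
    calc groupOrder gens * R ≤ groupOrder gens * (2 * (R / 2 + 1)) := Nat.mul_le_mul_left _ h₃
      _ = 2 * ((R / 2 + 1) * groupOrder gens) := by ring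
      _ ≤ _ := by omega
  refine (length_script_upper_le h.orders hR start).trans (Nat.mul_le_mul ?_ ?_)
  · have h₁ := (two_pow_length_le h.orders).trans (groupOrder_le h.card_eq)
    have := Nat.le_log_of_pow_le one_lt_two h₁
    omega
  · exact Nat.mul_le_mul_left _ (Nat.sqrt_le_sqrt hcard)

/-- One search for the order of `g = z[cur]` modulo the known subgroup `H`, with bound `R`, when it is
already known that no power `g ^ j` with `2 * j ≤ R` lies in `H`. -/
lemma Searching.ok_step {c T cur need R : ℕ} {ε : ℝ≥0∞} (h : Searching z facts gens cur)
    (hR : 1 ≤ R) {g : G} (hg : z.getD cur 1 = g) {H : Subgroup G}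
    (hH : span (fun k => z.getD k 1) gens = H) (hq : ∀ j, 1 ≤ j → 2 * j ≤ R → g ^ j ∉ H)
    (hwiden : (∀ j, 1 ≤ j → j ≤ R → g ^ j ∉ H) → ∀ (z' : List G) facts',
      Searching z' facts' gens cur → z'.getD cur 1 = g → span (fun k => z'.getD k 1) gens = H →
      Ok c T z' (widen ⟨gens, cur, R, need, z.length⟩ (answers z') facts') ε)
    (hin : g ∈ H → ∀ (z' : List G) facts' ph, Known z' facts' gens →
      span (fun k => z'.getD k 1) gens = H →
      (∀ x ∈ H, ∃ a < z'.length, ∃ b < z'.length, z'.getD a 1 * z'.getD b 1 = x) →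
      ph.gens = gens → Ok c T z' (if need ≤ 1 then finish ph (answers z') facts'
        else begin gens (need - 1) (answers z') facts') ε)
    (hout : g ∉ H → ∀ (z' : List G) facts' r, Known z' facts' (gens ++ [(cur, r)]) →
      span (fun k => z'.getD k 1) (gens ++ [(cur, r)]) = H ⊔ Subgroup.zpowers g →
      Ok c T z' (begin (gens ++ [(cur, r)]) (trials c (groupOrder (gens ++ [(cur, r)])))
        (answers z') facts') ε) :
    Ok c (T + tableCost (Fintype.card G)) z
      ⟨⟨gens, cur, R, need, z.length⟩, none,
        (Phase.mk gens cur R need z.length).upper.script.map some, answers z, facts⟩ ε := by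
  set ph : Phase := ⟨gens, cur, R, need, z.length⟩ with hph
  obtain ⟨z', facts', he, hok⟩ := ok_script (c := c) ph none facts ph.upper.script
    (script_upper_ne_nil h.orders hR _) (h.bounded hR).2.1
  have h' := h.extends (h.bounded hR).2.1 he
  have hg' : z'.getD cur 1 = g := (getD_of_prefix he.isPrefix h.cur_lt 1).trans hg
  have hH' : span (fun k => z'.getD k 1) gens = H := by
    rw [← hH]
    exact span_congr (κ := fun k => z'.getD k 1) (κ' := fun k => z.getD k 1) fun gm hgm =>
      getD_of_prefix he.isPrefix (h.regs_lt gm hgm) 1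
  have hcol : ∀ j, 1 ≤ j → j ≤ R → (g ^ j ∈ H ↔ ph.Collision (answers z') j) := by
    intro j hj hjR
    constructor
    · intro hmem
      exact h.collision hR he hj hjR (by rwa [hg', hH'])
    · intro hc
      have := h.pow_mem hR he hc h'.sound.sat
      rwa [h'.span_eq, getD_answers h'.cur_lt, hg', hH'] at this
  refine Ok.mono (hok (T := T) ?_)
    (Nat.add_le_add_left (h.script_le_tableCost hR hH hq _) _) le_rfl
  simp only [settle, if_true, plan]
  have hpos := ph.relOrder_pos (answers z')
  have hmin : ∀ j, 1 ≤ j → j ≤ R → j < ph.relOrder (answers z') → g ^ j ∉ H :=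
    fun j hj hjR hlt hmem => Phase.not_collision hj hlt ((hcol j hj hjR).1 hmem)
  by_cases hr : ph.bound < ph.relOrder (answers z')
  · rw [if_pos hr]
    exact hwiden (fun j hj hjR => hmin j hj hjR (lt_of_le_of_lt hjR hr)) z' facts' h' hg' hH'
  · rw [if_neg hr]
    have hrR : ph.relOrder (answers z') ≤ R := not_lt.1 hr
    have hc := ph.collision_relOrder (not_lt.1 hr)
    by_cases hr1 : ph.relOrder (answers z') = 1
    · rw [if_pos hr1]
      rw [hr1] at hc
      have hk := h.known_of_one hR he hc
      refine hin (by simpa using (hcol 1 le_rfl hR).2 hc) z' facts' ph hk hH' ?_ rfl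
      rw [← hH']
      exact h.exists_mul_eq hR he hk
    · rw [if_neg hr1]
      have hk := h.known_append hR he (r := ph.relOrder (answers z')) (by omega) hc
        (fun j hj hjr => by rw [hg', hH']; exact hmin j hj (by omega) hjr)
      have := hout (fun hmem => hmin 1 le_rfl hR (by omega) (by simpa using hmem)) z' facts' _ hk
        (by rw [span_append, hH']; simp only [hg'])
      rwa [groupOrder_append] at this

/-- The search for the relative order of `g = z[cur]`, with bound `R = 2 ^ q`, when it is already
known that no power `g ^ j` with `2 * j ≤ R` lies in the known subgroup. The bound has to be doubled
at most `d` times if `|G| ≤ 2 ^ (q + d)`. -/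
lemma Searching.ok {c T cur need q d : ℕ} {ε : ℝ≥0∞} (h : Searching z facts gens cur) (g : G)
    (hg : z.getD cur 1 = g) (H : Subgroup G) (hH : span (fun k => z.getD k 1) gens = H)
    (hq : ∀ j, 1 ≤ j → 2 * j ≤ 2 ^ q → g ^ j ∉ H)
    (hd : Fintype.card G ≤ 2 ^ (q + d))
    (hin : g ∈ H → ∀ (z' : List G) facts' ph, Known z' facts' gens →
      span (fun k => z'.getD k 1) gens = H →
      (∀ x ∈ H, ∃ a < z'.length, ∃ b < z'.length, z'.getD a 1 * z'.getD b 1 = x) →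
      ph.gens = gens → Ok c T z' (if need ≤ 1 then finish ph (answers z') facts'
        else begin gens (need - 1) (answers z') facts') ε)
    (hout : g ∉ H → ∀ (z' : List G) facts' r, Known z' facts' (gens ++ [(cur, r)]) →
      span (fun k => z'.getD k 1) (gens ++ [(cur, r)]) = H ⊔ Subgroup.zpowers g →
      Ok c T z' (begin (gens ++ [(cur, r)]) (trials c (groupOrder (gens ++ [(cur, r)])))
        (answers z') facts') ε) :
    Ok c (T + (d + 1) * tableCost (Fintype.card G)) z
      ⟨⟨gens, cur, 2 ^ q, need, z.length⟩, none,
        (Phase.mk gens cur (2 ^ q) need z.length).upper.script.map some, answers z, facts⟩ ε := by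
  induction d generalizing z facts q with
  | zero =>
    -- The bound is at least `|G|`, so the search succeeds.
    rw [zero_add, one_mul]
    refine h.ok_step Nat.one_le_two_pow hg hH hq (fun hw => ?_) hin hout
    refine absurd ?_ (hw (Fintype.card G) Fintype.card_pos hd)
    rw [pow_card_eq_one]
    exact one_mem H
  | succ d ih =>
    rw [add_mul, one_mul, ← add_assoc]
    refine h.ok_step Nat.one_le_two_pow hg hH hq (fun hw z' facts' h' hg' hH' => ?_)
      (fun hmem z' facts' ph h₁ h₂ h₃ h₄ =>
        (hin hmem z' facts' ph h₁ h₂ h₃ h₄).mono (Nat.le_add_right _ _) le_rfl)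
      (fun hmem z' facts' r h₁ h₂ =>
        (hout hmem z' facts' r h₁ h₂).mono (Nat.le_add_right _ _) le_rfl)
    have hpow : 2 ^ (q + 1) = 2 * 2 ^ q := by ring
    have := ih (q := q + 1) h' hg' hH' (fun j hj hjq => hw j hj (by omega))
      (by rwa [add_assoc, add_comm 1 d])
    rw [hpow] at this
    simp only [widen, length_answers]
    exact this

/-- The final stage: a chart is found, and the elements it describes are computed. -/
lemma Known.ok_finish {c : ℕ} {ε : ℝ≥0∞} (h : Known z facts gens)
    (hcov : ∀ x ∈ span (fun k => z.getD k 1) gens, ∃ a < z.length, ∃ b < z.length,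
      z.getD a 1 * z.getD b 1 = x) {ph : Phase} (hph : ph.gens = gens)
    (hε : span (fun k => z.getD k 1) gens ≠ ⊤ → 1 ≤ ε) :
    Ok c (Nat.log 2 (Fintype.card G)) z (finish ph (answers z) facts) ε := by
  obtain ⟨hF, hchart⟩ := findChart_spec (h.exists_chart hcov)
  set F := findChart (answers z) facts (groupOrder gens) with hFdef
  have hlt : ∀ f ∈ F, f.2.2.1 < z.length ∧ f.2.2.2 < z.length := fun f hf => by
    have := mem_characters.1 ((mem_charts.1 hF).2 f hf)
    rw [length_answers] at this
    exact this.2.2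
  have hlen : F.length ≤ Nat.log 2 (Fintype.card G) := by
    refine Nat.le_log_of_pow_le one_lt_two (le_trans ?_ (groupOrder_le h.card_eq))
    rw [← hchart.2.2.1]
    have := List.pow_card_le_prod (F.map Prod.fst) 2 fun d hd => by
      obtain ⟨f, hf, rfl⟩ := List.mem_map.1 hd
      exact hchart.1 f hf
    simpa using this
  have hfin : finish ph (answers z) facts = ⟨ph, some (regs z.length F.length),
      (F.map fun f => f.2.2).map some, answers z, facts⟩ := by
    simp [finish, hph, hFdef, Function.comp_def]
  rw [hfin]
  set sc := F.map fun f => f.2.2 with hsc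
  -- Once all products have been computed, the new registers hold a basis.
  have hout : ∀ z' : List G, z'.length = z.length + F.length →
      (∀ t (ht : t < F.length), z'.getD (z.length + t) 1 =
        z.getD F[t].2.2.1 1 * z.getD F[t].2.2.2 1) → ∀ facts',
      Ok c 0 z' ⟨ph, some (regs z.length F.length), [], answers z', facts'⟩ ε := by
    intro z' hz' hval facts'
    refine ok_output (l := regs z.length F.length) rfl (fun i hi => ?_) fun hnb => hε fun htop =>
      hnb ?_
    · rw [mem_regs] at hi
      omega
    · convert h.isBasis htop hchart hlt using 1
      refine List.ext_getElem (by simp) fun t ht _ => ?_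
      rw [List.getElem_map, List.getElem_map, getElem_regs]
      exact hval t (by simpa using ht)
  by_cases hne : sc = []
  · have hF0 : F = [] := by simpa [hsc] using hne
    refine Ok.mono (ε := ε) ?_ (Nat.zero_le _) le_rfl
    rw [hne]
    exact hout z (by simp [hF0]) (fun t ht => by simp [hF0] at ht) facts
  · have hv : Valid z.length sc := by
      intro t ht
      have ht' : t < F.length := by simpa [hsc] using ht
      have := hlt F[t] (List.getElem_mem ht')
      simp only [hsc, List.getElem_map]
      omega
    obtain ⟨z', facts', he, hok⟩ := ok_script (c := c) ph (some (regs z.length F.length)) facts sc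
      hne hv
    have hsclen : sc.length = F.length := by simp [hsc]
    refine Ok.mono (hok (T := 0) ?_) (by omega) le_rfl
    have hs := (he.sound h.sound).sat
    refine hout z' (by rw [he.length_eq, hsclen]) (fun t ht => ?_) facts'
    have hobeys := he.obeys G _ hs t (by omega)
    have hl := hlt F[t] (List.getElem_mem ht)
    have hle := he.isPrefix.length_le
    have hget : sc[t]'(by omega) = F[t].2.2 := by simp [hsc]
    rw [hget, getD_answers (by rw [he.length_eq]; omega), getD_answers (hl.1.trans_le hle),
      getD_answers (hl.2.trans_le hle), getD_of_prefix he.isPrefix hl.1,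
      getD_of_prefix he.isPrefix hl.2] at hobeys
    exact hobeys

end Cost

/-! ### Probability of failure and number of moves -/

lemma le_two_pow_bits (h : ℕ) : h ≤ 2 ^ bits h := by
  have hlt : bits h < (List.range (h + 1)).length := by
    rw [bits, List.findIdx_lt_length]
    exact ⟨h, by simp, by simpa using Nat.lt_two_pow_self.le⟩
  have := List.findIdx_getElem (w := hlt)
  exact (of_decide_eq_true this).trans_eq (congrArg (2 ^ ·) (List.getElem_range hlt))

lemma bits_le {h n : ℕ} (hn : h ≤ n) : bits h ≤ Nat.log 2 n + 1 := by
  by_contra hlt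
  have := List.not_of_lt_findIdx (not_le.1 hlt)
  rw [List.getElem_range] at this
  exact of_decide_eq_false this (hn.trans (Nat.lt_pow_succ_log_self one_lt_two n).le)

/-- An upper bound for the number of trials in a group of order `n`. -/
def maxTrials (c n : ℕ) : ℕ := (c + 1) * (Nat.log 2 n + 2)

lemma trials_le {c h n : ℕ} (hn : h ≤ n) : trials c h ≤ maxTrials c n :=
  Nat.mul_le_mul_left _ (Nat.succ_le_succ (bits_le hn))

lemma one_le_trials (c h : ℕ) : 1 ≤ trials c h := Nat.mul_pos (Nat.succ_pos _) (Nat.succ_pos _)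

/-- A proper subgroup of order `h` of a group of order `h * r` passes all trials with probability at
most `(h * r) ^ (-(c + 1))`. -/
lemma pow_trials_le (c : ℕ) {h r : ℕ} (hh : 1 ≤ h) (hr : 2 ≤ r) :
    ((h : ℝ≥0∞) * ((h * r : ℕ) : ℝ≥0∞)⁻¹) ^ trials c h ≤ (((h * r : ℕ) : ℝ≥0∞) ^ (c + 1))⁻¹ := by
  set n := h * r with hn
  have hn0 : n ≠ 0 := by positivity
  set t := trials c h with ht
  have key : h ^ t * n ^ (c + 1) ≤ n ^ t := by
    have h₁ : n ^ (c + 1) ≤ r ^ t := by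
      rw [ht, trials, mul_comm (c + 1), pow_mul]
      refine Nat.pow_le_pow_left ?_ _
      rw [pow_succ, hn]
      exact Nat.mul_le_mul_right _ ((le_two_pow_bits h).trans (Nat.pow_le_pow_left hr _))
    calc h ^ t * n ^ (c + 1) ≤ h ^ t * r ^ t := Nat.mul_le_mul_left _ h₁
      _ = n ^ t := by rw [hn, mul_pow]
  have hnt : (n : ℝ≥0∞) ^ t ≠ 0 := pow_ne_zero _ (by exact_mod_cast hn0)
  have hnt' : (n : ℝ≥0∞) ^ t ≠ ∞ := ENNReal.pow_ne_top (ENNReal.natCast_ne_top n)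
  rw [ENNReal.le_inv_iff_mul_le, mul_pow, ← ENNReal.inv_pow]
  calc (h : ℝ≥0∞) ^ t * ((n : ℝ≥0∞) ^ t)⁻¹ * (n : ℝ≥0∞) ^ (c + 1)
      = ((h ^ t * n ^ (c + 1) : ℕ) : ℝ≥0∞) * ((n : ℝ≥0∞) ^ t)⁻¹ := by push_cast; ring
    _ ≤ ((n ^ t : ℕ) : ℝ≥0∞) * ((n : ℝ≥0∞) ^ t)⁻¹ := by gcongr
    _ = 1 := by push_cast; exact ENNReal.mul_inv_cancel hnt hnt'

section Main

variable {G : Type u} [CommGroup G] [Fintype G]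

/-- An upper bound for the number of times that the subgroup `H` can be enlarged, since each time its
index is at least halved. -/
noncomputable def height (H : Subgroup G) : ℕ := Nat.log 2 H.index

lemma height_lt {H H' : Subgroup G} (h : H < H') : height H' + 1 ≤ height H := by
  have h₁ : H.relIndex H' * H'.index = H.index := Subgroup.relIndex_mul_index h.le
  have h₂ : H.relIndex H' ≠ 1 := fun h1 => h.not_ge (Subgroup.relIndex_eq_one.1 h1)
  have h₃ : H.relIndex H' ≠ 0 := fun h0 => H.index_ne_zero_of_finite (by rw [← h₁, h0, zero_mul])
  have h₄ : H'.index ≠ 0 := H'.index_ne_zero_of_finite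
  rw [height, height, ← Nat.log_mul_base one_lt_two h₄]
  refine Nat.log_mono_right ?_
  rw [← h₁, mul_comm]
  exact Nat.mul_le_mul_right _ (by omega)

/-- Bound for the probability of failure when `H` is known and `need` more random elements are
required to lie in `H`. -/
noncomputable def failure (c : ℕ) (H : Subgroup G) (need : ℕ) : ℝ≥0∞ :=
  open Classical in
  if H = ⊤ then 0 else
    ((Nat.card H : ℝ≥0∞) * (Fintype.card G : ℝ≥0∞)⁻¹) ^ need +
      height H * ((Fintype.card G : ℝ≥0∞) ^ (c + 1))⁻¹

/-- A new subgroup is wrongly accepted with probability at most `|G| ^ (-(c + 1))`. -/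
lemma failure_trials_le (c : ℕ) (H : Subgroup G) :
    failure c H (trials c (Nat.card H)) ≤
      (height H + 1 : ℕ) * ((Fintype.card G : ℝ≥0∞) ^ (c + 1))⁻¹ := by
  unfold failure
  split_ifs with h
  · exact zero_le
  · have h₁ : Nat.card H * H.index = Fintype.card G := by
      rw [← Nat.card_eq_fintype_card]
      exact H.card_mul_index
    have h₂ : 2 ≤ H.index := by
      have := H.index_ne_zero_of_finite
      have : H.index ≠ 1 := fun h1 => h (Subgroup.index_eq_one.1 h1)
      omega
    have := pow_trials_le c (h := Nat.card H) Nat.card_pos h₂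
    rw [h₁] at this
    push_cast
    rw [add_mul, one_mul, add_comm]
    gcongr

/-- The recursion for the probability of failure: with probability `|H| / |G|` the next random
element lies in `H`, and otherwise the subgroup grows. -/
lemma sum_failure_le (c : ℕ) {H : Subgroup G} {need : ℕ} (hneed : 1 ≤ need) [DecidablePred (· ∈ H)]
    (hH : H ≠ ⊤) :
    ∑ g : G, (Fintype.card G : ℝ≥0∞)⁻¹ *
      ((if g ∈ H then ((Nat.card H : ℝ≥0∞) * (Fintype.card G : ℝ≥0∞)⁻¹) ^ (need - 1) else 0) +
        height H * ((Fintype.card G : ℝ≥0∞) ^ (c + 1))⁻¹) ≤ failure c H need := by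
  have hn0 : (Fintype.card G : ℝ≥0∞) ≠ 0 := by exact_mod_cast Fintype.card_ne_zero
  have hcard : (Finset.univ.filter (· ∈ H)).card = Nat.card H := by
    rw [Nat.card_eq_fintype_card, Fintype.card_subtype]
  rw [failure, if_neg hH, ← Finset.mul_sum, Finset.sum_add_distrib, ← Finset.sum_filter,
    Finset.sum_const, Finset.sum_const, hcard, Finset.card_univ, nsmul_eq_mul, nsmul_eq_mul,
    mul_add]
  refine add_le_add (le_of_eq ?_) (le_of_eq ?_)
  · obtain ⟨k, rfl⟩ := Nat.exists_eq_add_of_le' hneed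
    rw [Nat.add_sub_cancel, pow_succ]
    ring
  · rw [← mul_assoc, ENNReal.inv_mul_cancel hn0 (ENNReal.natCast_ne_top _), one_mul]

/-- Bound for the number of moves between two random elements. -/
def roundCost (n : ℕ) : ℕ := 1 + (Nat.log 2 n + 2) * tableCost n

variable [DecidableEq G]

/-- The induction over the remaining rounds: each round either decreases `need` or enlarges the known
subgroup. -/
lemma Known.ok {c N need : ℕ} {z : List G} {facts : List (ℕ × ℕ × ℕ)} {gens : List (ℕ × ℕ)}
    (h : Known z facts gens) (H : Subgroup G) (hH : span (fun k => z.getD k 1) gens = H)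
    (hneed : 1 ≤ need) (hN : need + height H * maxTrials c (Fintype.card G) ≤ N) :
    Ok c (N * roundCost (Fintype.card G) + Nat.log 2 (Fintype.card G)) z
      (begin gens need (answers z) facts) (failure c H need) := by
  classical
  induction N generalizing need z facts gens H with
  | zero => omega
  | succ N ih =>
    set n := Fintype.card G with hn
    set T := N * roundCost n + Nat.log 2 n with hT
    set δ := (height H : ℝ≥0∞) * ((n : ℝ≥0∞) ^ (c + 1))⁻¹ with hδ
    -- The bound for the probability of failure after the next random element turned out to be `g`.
    let ε : G → ℝ≥0∞ := fun g => if H = ⊤ then 0 else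
      (if g ∈ H then ((Nat.card H : ℝ≥0∞) * (n : ℝ≥0∞)⁻¹) ^ (need - 1) else 0) + δ
    have hmain : ∀ g, Ok c (T + (Nat.log 2 n + 2) * tableCost n) (z ++ [g])
        (update c (begin gens need (answers z) facts) (z.idxOf g)) (ε g) := by
      intro g
      have hsearch := h.sample g
      have hz1 : (z ++ [g]).length = (answers z).length + 1 := by simp
      have hmem : update c (begin gens need (answers z) facts) (z.idxOf g) =
          ⟨⟨gens, z.length, 2 ^ 0, need, (z ++ [g]).length⟩, none,
            (Phase.mk gens z.length (2 ^ 0) need (z ++ [g]).length).upper.script.map some,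
            answers (z ++ [g]), facts⟩ := by
        rw [begin, update_mk, if_neg (by
          simpa using script_upper_ne_nil h.orders le_rfl _), hz1, answers_append_singleton]
        simp
      rw [hmem]
      refine hsearch.ok g (by simp) H ?_ (fun j hj hj1 => by omega) (d := Nat.log 2 n + 1)
        (by rw [zero_add]; exact (Nat.lt_pow_succ_log_self one_lt_two n).le) ?_ ?_
      · rw [← hH]
        exact span_congr (κ := fun k => (z ++ [g]).getD k 1) (κ' := fun k => z.getD k 1)
          fun gm hgm => getD_of_prefix (List.prefix_append _ _) (h.regs_lt gm hgm) 1
      · intro hg z' facts' ph hk hspan hcov hph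
        split_ifs with hneed1
        · have hneed0 : need - 1 = 0 := by omega
          rw [← hspan] at hcov
          refine (hk.ok_finish hcov hph (ε := ε g) ?_).mono (Nat.le_add_left _ _) le_rfl
          intro htop
          rw [hspan] at htop
          simp only [ε, if_neg htop, if_pos hg, hneed0, pow_zero]
          exact le_self_add
        · refine (ih hk H hspan (by omega) (by omega)).mono le_rfl ?_
          simp only [ε, failure, hδ, if_pos hg]
          exact le_of_eq rfl
      · intro hg z' facts' r hk hspan
        have hlt : H < H ⊔ Subgroup.zpowers g :=
          lt_of_le_of_ne le_sup_left fun heq =>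
            hg (heq ▸ Subgroup.mem_sup_right (Subgroup.mem_zpowers g))
        have hheight := height_lt hlt
        have hcard : Nat.card ↥(H ⊔ Subgroup.zpowers g) =
            groupOrder (gens ++ [(z.length, r)]) := by rw [← hspan, hk.card_eq]
        have htr : trials c (groupOrder (gens ++ [(z.length, r)])) ≤ maxTrials c n :=
          trials_le (groupOrder_le hk.card_eq)
        refine (ih hk _ hspan (one_le_trials _ _) ?_).mono le_rfl ?_
        · have := Nat.mul_le_mul_right (maxTrials c n) hheight
          rw [add_mul, one_mul] at this
          omega
        · have htop : H ≠ ⊤ := fun htop => hg (htop ▸ Subgroup.mem_top g)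
          simp only [ε, if_neg htop, if_neg hg, zero_add]
          rw [← hcard]
          refine (failure_trials_le c _).trans ?_
          rw [hδ]
          gcongr
    have := ok_sample (c := c) (m := begin gens need (answers z) facts) rfl hmain
    refine this.mono (le_of_eq ?_) ?_
    · rw [hT, roundCost]
      ring
    · by_cases htop : H = ⊤
      · simp [ε, htop]
      · simp only [ε, if_neg htop]
        exact sum_failure_le c hneed htop

lemma known_nil {G : Type u} [CommGroup G] [DecidableEq G] : Known ([] : List G) [] [] := by
  refine ⟨by simp [Sound], by simp, by simp, fun K _ ζ _ => chain_nil, by simp, ?_⟩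
  simp [groupOrder]

/-- The total number of rounds. -/
def rounds (c n : ℕ) : ℕ := trials c 1 + Nat.log 2 n * maxTrials c n

/-- From the start, the algorithm fails with probability at most `|G| ^ (-c)`: at most `|G|` subgroups
are encountered, each of which is wrongly accepted with probability at most `|G| ^ (-(c + 1))`. -/
lemma ok_init (c : ℕ) (G : Type u) [CommGroup G] [Fintype G] [DecidableEq G] :
    Ok c (rounds c (Fintype.card G) * roundCost (Fintype.card G) + Nat.log 2 (Fintype.card G))
      ([] : List G) (begin [] (trials c 1) [] []) (((Fintype.card G : ℝ≥0∞) ^ c)⁻¹) := by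
  have hheight : height (⊥ : Subgroup G) = Nat.log 2 (Fintype.card G) := by
    rw [height, Subgroup.index_bot, Nat.card_eq_fintype_card]
  refine (known_nil.ok (c := c) (N := rounds c (Fintype.card G)) (need := trials c 1)
    (⊥ : Subgroup G) span_nil (one_le_trials _ _) (by rw [hheight]; rfl)).mono le_rfl ?_
  have hfail := failure_trials_le c (⊥ : Subgroup G)
  rw [Subgroup.card_bot, hheight] at hfail
  refine hfail.trans ?_
  set n := Fintype.card G with hn
  have hn0 : (n : ℝ≥0∞) ≠ 0 := by exact_mod_cast Fintype.card_ne_zero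
  have hlog : Nat.log 2 n + 1 ≤ n := Nat.log_lt_self 2 Fintype.card_ne_zero
  calc ((Nat.log 2 n + 1 : ℕ) : ℝ≥0∞) * ((n : ℝ≥0∞) ^ (c + 1))⁻¹
      ≤ (n : ℝ≥0∞) * ((n : ℝ≥0∞) ^ (c + 1))⁻¹ := by gcongr
    _ = ((n : ℝ≥0∞) ^ c)⁻¹ := by
        rw [pow_succ', ENNReal.mul_inv (Or.inl hn0) (Or.inl (ENNReal.natCast_ne_top n)),
          ← mul_assoc, ENNReal.mul_inv_cancel hn0 (ENNReal.natCast_ne_top n), one_mul]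

end Main

/-- The number of moves is `O(√n * (1 + log n) ^ 4)`: there are `O(log² n)` rounds with `O(log n)`
searches each, and a search costs `O(√n * log n)` moves. -/
lemma moves_le (c : ℕ) {n : ℕ} (hn : 1 ≤ n) :
    ((rounds c n * roundCost n + Nat.log 2 n : ℕ) : ℝ) ≤
      (384 * (c + 1)) * √n * (1 + Real.log n) ^ 4 := by
  set l := Nat.log 2 n with hl
  set S := (2 * n).sqrt with hS
  have hS1 : 1 ≤ S := by
    rw [hS, Nat.le_sqrt]; omega
  have hround : roundCost n ≤ 11 * S * (l + 2) ^ 2 := by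
    rw [roundCost, tableCost, ← hl, ← hS]
    nlinarith [Nat.zero_le l, Nat.zero_le (l * S), Nat.zero_le (l ^ 2 * S)]
  have hrounds : rounds c n ≤ (c + 1) * (l + 2) ^ 2 := by
    have h₁ : trials c 1 ≤ maxTrials c n := trials_le hn
    rw [rounds, ← hl]
    calc trials c 1 + l * maxTrials c n ≤ (l + 1) * maxTrials c n := by linarith
      _ ≤ (l + 2) * ((c + 1) * (l + 2)) := Nat.mul_le_mul (by omega) le_rfl
      _ = _ := by ring
  have hnat : rounds c n * roundCost n + l ≤ 12 * (c + 1) * S * (l + 2) ^ 4 := by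
    have h₁ := Nat.mul_le_mul hrounds hround
    have h₂ : l ≤ (c + 1) * S * (l + 2) ^ 4 := by
      calc l ≤ 1 * 1 * (l + 2) ^ 1 := by rw [pow_one]; omega
        _ ≤ (c + 1) * S * (l + 2) ^ 4 :=
          Nat.mul_le_mul (Nat.mul_le_mul (by omega) hS1) (Nat.pow_le_pow_right (by omega) (by omega))
    calc _ ≤ (c + 1) * (l + 2) ^ 2 * (11 * S * (l + 2) ^ 2) + (c + 1) * S * (l + 2) ^ 4 :=
          add_le_add h₁ h₂
      _ = _ := by ring
  have hSr : (S : ℝ) ≤ 2 * √n := by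
    have h₁ : (S : ℝ) ≤ √((2 * n : ℕ) : ℝ) := Real.nat_sqrt_le_real_sqrt
    refine h₁.trans ?_
    rw [show (2 : ℝ) * √n = √(4 * n) by
      rw [Real.sqrt_mul (by norm_num), show (4 : ℝ) = 2 ^ 2 by norm_num,
        Real.sqrt_sq (by norm_num)]]
    refine Real.sqrt_le_sqrt ?_
    push_cast
    nlinarith [Nat.cast_nonneg (α := ℝ) n]
  have hlr : (l : ℝ) + 2 ≤ 2 * (1 + Real.log n) := by
    have h₁ : ((2 ^ l : ℕ) : ℝ) ≤ n := by exact_mod_cast Nat.pow_log_le_self 2 (by omega)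
    have h₂ := Real.log_le_log (by positivity) h₁
    push_cast at h₂
    rw [Real.log_pow] at h₂
    nlinarith [Real.log_two_gt_d9, Nat.cast_nonneg (α := ℝ) l]
  calc ((rounds c n * roundCost n + l : ℕ) : ℝ)
      ≤ ((12 * (c + 1) * S * (l + 2) ^ 4 : ℕ) : ℝ) := by exact_mod_cast hnat
    _ = 12 * (c + 1) * S * ((l : ℝ) + 2) ^ 4 := by push_cast; ring
    _ ≤ 12 * (c + 1) * (2 * √n) * (2 * (1 + Real.log n)) ^ 4 := by gcongr
    _ = _ := by ring

end BasisSearch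

theorem mainTheorem2 (c : ℕ) :
    ∃ (A : CayleyOracle.Algorithm) (C : ℝ) (k : ℕ),
      ∀ (G : Type*) [CommGroup G] [Fintype G] [DecidableEq G],
        ∃ T : ℕ,
          (T : ℝ) ≤ C * √(Fintype.card G) * (1 + Real.log (Fintype.card G)) ^ k ∧
          (∀ o ∈ (A.run T ([] : List G) A.init).support, o ≠ none) ∧
          1 - ((Fintype.card G : ENNReal) ^ c)⁻¹ ≤
            (A.run T ([] : List G) A.init).toOuterMeasure
              {o | ∃ l : List G, o = some l ∧ CayleyOracle.IsBasis l} := by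
  refine ⟨BasisSearch.algorithm c, 384 * (c + 1), 4, fun G _ _ _ => ⟨_,
    BasisSearch.moves_le c Fintype.card_pos, ?_, ?_⟩⟩
  · rintro o ho rfl
    exact (BasisSearch.ok_init c G _ le_rfl).1 ho
  · have h := (BasisSearch.ok_init c G _ le_rfl).2
    set p := (BasisSearch.algorithm c).run _ ([] : List G) (BasisSearch.algorithm c).init
    rw [tsub_le_iff_right]
    have huniv : p.toOuterMeasure Set.univ = 1 :=
      (p.toOuterMeasure_apply_eq_one_iff _).2 (Set.subset_univ _)
    rw [← huniv, ← Set.union_compl_self {o | ∃ l : List G, o = some l ∧ CayleyOracle.IsBasis l}]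
    exact (MeasureTheory.measure_union_le _ _).trans (add_le_add le_rfl h)
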